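/- Let $\mathbb{F}_q$ be a finite field and let $A=(a_{ij})\in\mathbb{F}_q^{m\times k}$. Consider the linear system $$(\star)\qquad a_{i1}x_1+\cdots+a_{ik}x_k=0\qquad(i=1,\ldots,m)$$ in variables $x_1,\ldots,x_k\in\mathbb{F}_q^n$. Call a linear equation $b_1x_1+\cdots+b_kx_k=0$ with $b_j\in\mathbb{F}_q$ balanced if $b_1+\cdots+b_k=0$. Call two indices $j,j'\in\{1,\ldots,k\}$ equivalent if the corresponding columns of $A$ are nonzero scalar multiples of one another; the classes of this equivalence relation are the column equivalence classes, and $\ell$ denotes their number. A column equivalence class sums to zero if the columns indexed by it add up to the zero vector. Assume that: - $(\star)$ is of type (RC): every equation of $(\star)$ is balanced, and at most one column equivalence class has size $1$; - $(\star)$ is non-degenerate: the rows of $A$ are linearly independent, and every variable occurs with nonzero coefficient in at least one equation; - $(\star)$ is irreducible: there is no linear system $(\star')$ in the same variables such that each equation of $(\star)$ is a linear combination of the equations of $(\star')$ and vice versa, and such that $x_1,\ldots,x_k$ can be partitioned into two or more (nonempty) classes in such a way that every equation of $(\star')$ only uses variables from one partition class. Suppose moreover that at least one of the following holds: (i) none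 of the column equivalence classes sums to zero, and $\ell=m+1$; (ii) every column equivalence class sums to zero. Then $(\star)$ is temperate: there exist constants $\beta,\gamma>0$ with $\gamma<q$ such that, for every $n$, every subset $S\subseteq\mathbb{F}_q^n$ with $|S|\geq\beta\cdot\gamma^n$ contains a generic solution of $(\star)$, that is, a solution $(x_1,\ldots,x_k)\in S^k$ of $(\star)$ such that every balanced linear equation over $\mathbb{F}_q$ satisfied by $(x_1,\ldots,x_k)$ is a linear combination of the equations of $(\star)$. -/

import Mathlib

/-! A linear system `(⋆)` of `m` equations in `k` variables over a field `F` is given by its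
coefficient matrix `A : Matrix (Fin m) (Fin k) F`; its variables take values in `Fin n → F`. -/

namespace LinSys

variable {F : Type*} [Field F] {m k : ℕ}

/-- The linear span of the equations (rows) of the system. -/
def rowSpan (A : Matrix (Fin m) (Fin k) F) : Submodule F (Fin k → F) :=
  Submodule.span F (Set.range A.row)

/-- The coefficients of every equation sum to zero. -/
def IsBalanced (A : Matrix (Fin m) (Fin k) F) : Prop :=
  ∀ i, ∑ j, A i j = 0

/-- The rows are linearly independent and every variable is used. -/
def IsNondegenerate (A : Matrix (Fin m) (Fin k) F) : Prop :=
  LinearIndependent F A.row ∧ ∀ j, ∃ i, A i j ≠ 0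

/-- Each equation of either system is a linear combination of the equations of the other. -/
def IsEquivalent {m' : ℕ} (A : Matrix (Fin m) (Fin k) F) (A' : Matrix (Fin m') (Fin k) F) : Prop :=
  (∀ i, A.row i ∈ rowSpan A') ∧ ∀ i, A'.row i ∈ rowSpan A

/-- The system is equivalent to one for which the variables can be partitioned into two or more
(nonempty) classes such that every equation only uses variables from one class. -/
def IsReducible (A : Matrix (Fin m) (Fin k) F) : Prop :=
  ∃ (m' : ℕ) (A' : Matrix (Fin m') (Fin k) F), IsEquivalent A A' ∧
    ∃ P : Finpartition (Finset.univ : Finset (Fin k)), 2 ≤ P.parts.card ∧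
      ∀ i, ∃ C ∈ P.parts, ∀ j, A' i j ≠ 0 → j ∈ C

/-- Two indices are equivalent if their columns are nonzero scalar multiples of one another. -/
def columnSetoid (A : Matrix (Fin m) (Fin k) F) : Setoid (Fin k) where
  r j j' := ∃ c : F, c ≠ 0 ∧ A.col j' = c • A.col j
  iseqv :=
    { refl := fun _ => ⟨1, one_ne_zero, (one_smul F _).symm⟩
      symm := by
        rintro j j' ⟨c, hc, h⟩
        exact ⟨c⁻¹, inv_ne_zero hc, by rw [h, smul_smul, inv_mul_cancel₀ hc, one_smul]⟩
      trans := by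
        rintro j j' j'' ⟨c, hc, h⟩ ⟨d, hd, h'⟩
        exact ⟨d * c, mul_ne_zero hd hc, by rw [h', h, smul_smul]⟩ }

open Classical in
/-- The column equivalence classes. -/
noncomputable def columnClasses (A : Matrix (Fin m) (Fin k) F) : Finset (Finset (Fin k)) :=
  (Finpartition.ofSetoid (columnSetoid A)).parts

/-- The columns indexed by `C` add up to the zero vector. -/
def SumsToZero (A : Matrix (Fin m) (Fin k) F) (C : Finset (Fin k)) : Prop :=
  ∑ j ∈ C, A.col j = 0

/-- Type (RC): balanced, with at most one column equivalence class of size `1`. -/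
def IsTypeRC (A : Matrix (Fin m) (Fin k) F) : Prop :=
  IsBalanced A ∧ ((columnClasses A).filter fun C => C.card = 1).card ≤ 1

/-- The vectors `x₁, …, xₖ` satisfy every equation of the system. -/
def IsSolution {n : ℕ} (A : Matrix (Fin m) (Fin k) F) (x : Fin k → Fin n → F) : Prop :=
  ∀ i, ∑ j, A i j • x j = 0

/-- A solution such that every balanced linear equation satisfied by it is a linear combination
of the equations of the system. -/
def IsGenericSolution {n : ℕ} (A : Matrix (Fin m) (Fin k) F) (x : Fin k → Fin n → F) : Prop :=
  IsSolution A x ∧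
    ∀ b : Fin k → F, ∑ j, b j = 0 → ∑ j, b j • x j = 0 → b ∈ rowSpan A

/-- There are constants `β, γ > 0` with `γ < q` such that, for every `n`, every `S ⊆ F_q^n` with
`|S| ≥ β γ ^ n` contains a generic solution. -/
def IsTemperate [Fintype F] (A : Matrix (Fin m) (Fin k) F) : Prop :=
  ∃ β γ : ℝ, 0 < β ∧ 0 < γ ∧ γ < Fintype.card F ∧
    ∀ (n : ℕ) (S : Finset (Fin n → F)), β * γ ^ n ≤ S.card →
      ∃ x : Fin k → Fin n → F, (∀ j, x j ∈ S) ∧ IsGenericSolution A x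

end LinSys

section

open Finset

/-! The theorem follows by counting. Over the whole space the system has about `q ^ ((k - m) * n)`
solutions. A solution that is not generic satisfies one more independent equation, so there are at
most `q ^ k * q ^ ((k - m - 1) * n)` of those. It therefore suffices that a set of nearly full
exponential density contains `q ^ ((k - m - ε) * n)` solutions (`HasManySolutions`,
`HasManySolutions.isTemperate`).

The engine is a statement on one list of weights with nonzero sum `s`: a dense `S` contains some `z`
for which `s • z` has a nearly maximal number of representations as a weighted sum of elements of
`S` (`isPopular_of_sum_ne_zero`). For two weights this is supersaturation for the three-term
equation `a x + b y = (a + b) z`: the slice rank method bounds sets without nontrivial solutions,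
and averaging over affine maps turns existence into a count. For weights `s, a, -a` it is
Cauchy–Schwarz. Longer lists are built by substituting a list for a single weight equal to its sum
(`IsPopular.append`). Since unpopular elements form a small set, most elements of `S` are popular,
even for several lists at once.

Within a column class the system only sees one weighted sum. If no class sums to zero, representing
multiples of a common popular `z` in all classes solves the system because it is balanced; with `m +
1` classes the count is `1 + ∑ (|C| - 1) = k - m` in the exponent. If all classes sum to zero, one
member of each class is split off, with coefficient `1`, and the others have weights summing to
`-1`, so that they represent `-u C` for popular `u C`. What remains is to find pairs of families on
which the system takes equal values, and Cauchy–Schwarz supplies `q ^ ((2ℓ - m) * n)` of these up to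
`ε`. -/

/-! ### Slice rank of diagonal tensors. -/

/-- A vector of maximal support works: were its support smaller than the dimension, some nonzero
vector of `W` would vanish on that support, and adding it would enlarge the support. -/
theorem exists_mem_finrank_le_card_support {K ι : Type*} [Field K] [Fintype ι] [DecidableEq ι]
    [DecidableEq K] (W : Submodule K (ι → K)) :
    ∃ w ∈ W, Module.finrank K W ≤ #{i | w i ≠ 0} := by
  classical
  let size : W → ℕ := fun w => #{i | w.1 i ≠ 0}
  have hfin : (Set.range size).Finite :=
    (Set.finite_Iic (Fintype.card ι)).subset (by
      rintro _ ⟨w, rfl⟩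
      exact card_le_univ _)
  obtain ⟨_, ⟨⟨w, rfl⟩, hmax⟩⟩ := hfin.exists_maximal (Set.range_nonempty size)
  refine ⟨w.1, w.2, ?_⟩
  by_contra! hlt
  let s : Finset ι := {i | w.1 i ≠ 0}
  let res : W →ₗ[K] (s → K) := (LinearMap.funLeft K K (fun i : s => i.1)).comp W.subtype
  have hker : ∃ v, v ≠ 0 ∧ res v = 0 := by
    have hni : ¬ Function.Injective res := by
      intro hinj
      have := LinearMap.finrank_le_finrank_of_injective hinj
      rw [Module.finrank_pi, Fintype.card_coe] at this
      exact absurd this (not_le.2 hlt)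
    rw [← LinearMap.ker_eq_bot, Submodule.eq_bot_iff] at hni
    push Not at hni
    obtain ⟨v, hv, hv0⟩ := hni
    exact ⟨v, hv0, hv⟩
  obtain ⟨v, hv0, hv⟩ := hker
  have hvs : ∀ i, w.1 i ≠ 0 → v.1 i = 0 := fun i hi =>
    congrFun hv ⟨i, by simp [s, hi]⟩
  obtain ⟨i, hi⟩ : ∃ i, v.1 i ≠ 0 := by
    by_contra! h
    exact hv0 (Subtype.ext (funext h))
  have hlt' : size w < size (w + v) := by
    refine card_lt_card (Finset.ssubset_iff_subset_ne.2 ⟨fun j hj => ?_, fun heq => ?_⟩)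
    · have hj' : w.1 j ≠ 0 := by simpa using hj
      simp [hvs j hj', hj']
    · have hw : w.1 i = 0 := by
        by_contra h
        exact hi (hvs i h)
      have hm : i ∈ ({i | (w + v).1 i ≠ 0} : Finset ι) := by simp [hw, hi]
      rw [← heq] at hm
      simp [hw] at hm
  exact absurd (hmax ⟨_, rfl⟩ hlt'.le) (not_le.2 hlt')

/-- The slice rank of a diagonal tensor of order three. -/
theorem card_le_of_diagonal_eq_sum_slices {K ι M : Type*} [Field K] [Fintype ι] [DecidableEq ι]
    [Fintype M] (p : M → ι → K) (f g h : M → ι → ι → K)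
    (hd : ∀ x y z, (if x = y ∧ x = z then 1 else 0) =
      ∑ α, p α x * f α y z + ∑ α, p α y * g α x z + ∑ α, p α z * h α x y) :
    Fintype.card ι ≤ 3 * Fintype.card M := by
  classical
  let ev : (ι → K) →ₗ[K] (M → K) := Matrix.mulVecLin (Matrix.of p)
  -- Contracting the third variable with a `w` orthogonal to every `p α` kills the third family of
  -- slices. What is left is a diagonal matrix of rank at most `2 * Fintype.card M`, while `w` has
  -- at least `Fintype.card ι - Fintype.card M` nonzero entries.
  obtain ⟨w, hw, hcard⟩ := exists_mem_finrank_le_card_support (LinearMap.ker ev)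
  have hrn := LinearMap.finrank_range_add_finrank_ker ev
  have hr : Module.finrank K (LinearMap.range ev) ≤ Fintype.card M :=
    (Submodule.finrank_le _).trans (Module.finrank_pi K).le
  rw [Module.finrank_pi] at hrn
  have hw' : ∀ α, ∑ z, p α z * w z = 0 := fun α => congrFun hw α
  let A : Matrix ι M K := Matrix.of fun x α => p α x
  let B : Matrix M ι K := Matrix.of fun α y => ∑ z, f α y z * w z
  let C : Matrix ι M K := Matrix.of fun x α => ∑ z, g α x z * w z
  let D : Matrix M ι K := Matrix.of fun α y => p α y
  have hdiag : Matrix.diagonal w = Matrix.fromCols A C * Matrix.fromRows B D := by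
    rw [Matrix.fromCols_mul_fromRows]
    ext x y
    have h1 : Matrix.diagonal w x y = ∑ z, (if x = y ∧ x = z then 1 else 0) * w z := by
      by_cases hxy : x = y
      · subst hxy
        simp
      · simp [hxy]
    rw [h1]
    simp_rw [hd, add_mul, sum_add_distrib, Matrix.add_apply, Matrix.mul_apply, sum_mul]
    have h3 : ∑ z, ∑ α, p α z * h α x y * w z = 0 := by
      rw [sum_comm]
      refine sum_eq_zero fun α _ => ?_
      rw [← zero_mul (h α x y), ← hw' α, sum_mul]
      exact sum_congr rfl fun z _ => by ring
    rw [h3, add_zero]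
    congr 1
    · rw [sum_comm]
      refine sum_congr rfl fun α _ => ?_
      simp only [A, B, Matrix.of_apply, mul_sum]
      exact sum_congr rfl fun z _ => by ring
    · rw [sum_comm]
      refine sum_congr rfl fun α _ => ?_
      simp only [C, D, Matrix.of_apply, sum_mul]
      exact sum_congr rfl fun z _ => by ring
  have hrank : #{i | w i ≠ 0} ≤ 2 * Fintype.card M := by
    rw [← Fintype.card_subtype, ← Matrix.rank_diagonal, hdiag]
    refine (Matrix.rank_mul_le_left _ _).trans ((Matrix.rank_le_card_width _).trans ?_)
    rw [Fintype.card_sum]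
    omega
  omega

/-! ### The polynomial method for three-term equations. -/

/-- Exponent vectors of the monomials in `n` variables with degree less than `q` in each variable
and total degree at most a third of `(q - 1) n`. -/
def lowDegree (q n : ℕ) : Finset (Fin n → Fin q) :=
  univ.filter fun α => 3 * ∑ i, (α i : ℕ) ≤ (q - 1) * n

/-- For `D = q - 1` the left side is the indicator of `a * x + b * y + c * z = 0`. Only the degree
bound on its monomials matters later, so repeated monomials are not collected. -/
theorem exists_one_sub_pow_eq_sum {F : Type*} [Field F] (a b c : F) (D : ℕ) :
    ∃ (J : Type) (_ : Fintype J) (w : J → F) (e : Fin 3 → J → ℕ),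
      (∀ j, e 0 j + e 1 j + e 2 j ≤ D) ∧
      ∀ x y z : F, 1 - (a * x + b * y + c * z) ^ D =
        ∑ j, w j * (x ^ e 0 j * y ^ e 1 j * z ^ e 2 j) := by
  have key : ∃ (J : Type) (_ : Fintype J) (w : J → F) (e : Fin 3 → J → ℕ),
      (∀ j, e 0 j + e 1 j + e 2 j ≤ D) ∧
      ∀ x y z : F, (a * x + b * y + c * z) ^ D =
        ∑ j, w j * (x ^ e 0 j * y ^ e 1 j * z ^ e 2 j) := by
    induction D with
    | zero => exact ⟨Unit, inferInstance, fun _ => 1, fun _ _ => 0, by simp, by simp⟩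
    | succ D ih =>
      obtain ⟨J, _, w, e, he, hw⟩ := ih
      refine ⟨J × Fin 3, inferInstance, fun j => w j.1 * ![a, b, c] j.2,
        fun i j => e i j.1 + if i = j.2 then 1 else 0, ?_, fun x y z => ?_⟩
      · rintro ⟨j, i⟩
        have := he j
        fin_cases i <;> simp <;> omega
      · rw [pow_succ, hw, sum_mul, Fintype.sum_prod_type]
        refine sum_congr rfl fun j _ => ?_
        simp [Fin.sum_univ_three]
        ring
  obtain ⟨J, _, w, e, he, hw⟩ := key
  -- The extra index `none` carries the constant term `1`.
  refine ⟨Option J, inferInstance, fun j => j.elim 1 (fun j => - w j),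
    fun i j => j.elim 0 (e i), ?_, fun x y z => ?_⟩
  · rintro (_ | j)
    · simp
    · exact he j
  · rw [hw, Fintype.sum_option]
    simp [sub_eq_add_neg]

/-- Collecting the terms that share a factor `p α` turns a sum over monomials into a sum of slices.
-/
theorem sum_mul_eq_sum_fiberwise {R σ M : Type*} [CommSemiring R] [DecidableEq M] {T : Finset σ}
    {s : Finset M} {m : σ → M} (hm : ∀ τ ∈ T, m τ ∈ s) (p : M → R) (G : σ → R) :
    ∑ τ ∈ T, p (m τ) * G τ = ∑ α : s, p α * ∑ τ ∈ T with m τ = α, G τ := by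
  rw [sum_coe_sort s fun α => p α * ∑ τ ∈ T with m τ = α, G τ,
    ← sum_fiberwise_of_maps_to hm]
  refine sum_congr rfl fun α _ => ?_
  rw [mul_sum]
  refine sum_congr rfl fun τ hτ => ?_
  rw [(mem_filter.1 hτ).2]

/-- A subset of `F_q^n` in which `a x + b y + c z = 0` has only constant solutions is small. -/
theorem card_le_three_mul_card_lowDegree {F : Type*} [Field F] [Fintype F] [DecidableEq F]
    {a b c : F} (hc : c ≠ 0) (habc : a + b + c = 0) {n : ℕ} (S : Finset (Fin n → F))
    (hS : ∀ x ∈ S, ∀ y ∈ S, ∀ z ∈ S, a • x + b • y + c • z = 0 → x = y) :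
    #S ≤ 3 * #(lowDegree (Fintype.card F) n) := by
  classical
  set q := Fintype.card F with hq
  have hq0 : 0 < q := Fintype.card_pos
  obtain ⟨J, _, w, e, he, hw⟩ := exists_one_sub_pow_eq_sum a b c (q - 1)
  have hlt : ∀ i j, e i j < q := by
    intro i j
    have := he j
    fin_cases i <;> simp <;> omega
  let ex : Fin 3 → (Fin n → J) → (Fin n → Fin q) := fun i τ t => ⟨e i (τ t), hlt i (τ t)⟩
  let mon : (Fin n → Fin q) → (Fin n → F) → F := fun α x => ∏ t, x t ^ (α t : ℕ)
  let cf : (Fin n → J) → F := fun τ => ∏ t, w (τ t)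
  have hexp : ∀ x y z : Fin n → F,
      ∏ t, (1 - (a * x t + b * y t + c * z t) ^ (q - 1)) =
        ∑ τ : Fin n → J, cf τ * (mon (ex 0 τ) x * mon (ex 1 τ) y * mon (ex 2 τ) z) := by
    intro x y z
    simp_rw [hw]
    rw [prod_univ_sum, Fintype.piFinset_univ]
    refine sum_congr rfl fun τ _ => ?_
    simp only [cf, mon, ex, ← prod_mul_distrib]
  have hind : ∀ x y z : S, (if x = y ∧ x = z then (1 : F) else 0) =
      ∏ t, (1 - (a * x.1 t + b * y.1 t + c * z.1 t) ^ (q - 1)) := by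
    intro x y z
    by_cases h0 : a • x.1 + b • y.1 + c • z.1 = 0
    · have hxy : x = y := Subtype.ext (hS _ x.2 _ y.2 _ z.2 h0)
      have hxz : x = z := by
        subst hxy
        have : c • z.1 = c • x.1 := by
          have hab : a + b = -c := by linear_combination habc
          rw [← add_smul, hab, neg_smul, neg_add_eq_zero] at h0
          exact h0.symm
        exact Subtype.ext (smul_right_injective _ hc this).symm
      rw [if_pos ⟨hxy, hxz⟩, eq_comm]
      refine prod_eq_one fun t _ => ?_
      have ht : a * x.1 t + b * y.1 t + c * z.1 t = 0 := congrFun h0 t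
      rw [ht, zero_pow, sub_zero]
      have := Fintype.one_lt_card (α := F)
      omega
    · rw [if_neg, eq_comm]
      · obtain ⟨t, ht⟩ : ∃ t, a * x.1 t + b * y.1 t + c * z.1 t ≠ 0 := by
          by_contra! h
          exact h0 (funext h)
        refine prod_eq_zero (mem_univ t) ?_
        rw [FiniteField.pow_card_sub_one_eq_one _ ht, sub_self]
      · rintro ⟨rfl, rfl⟩
        rw [← add_smul, ← add_smul, habc, zero_smul] at h0
        exact h0 rfl
  -- Each product monomial has total degree at most `(q - 1) * n`, so its part in one of the three
  -- variables has degree at most a third of that. The monomials are sorted by the first variable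
  -- for which this happens.
  let T0 : Finset (Fin n → J) := univ.filter fun τ => ex 0 τ ∈ lowDegree q n
  let T1 : Finset (Fin n → J) := univ.filter fun τ => ex 0 τ ∉ lowDegree q n ∧
    ex 1 τ ∈ lowDegree q n
  let T2 : Finset (Fin n → J) := univ.filter fun τ => ex 0 τ ∉ lowDegree q n ∧
    ex 1 τ ∉ lowDegree q n
  have h2 : ∀ τ ∈ T2, ex 2 τ ∈ lowDegree q n := by
    intro τ hτ
    obtain ⟨h0, h1⟩ := (mem_filter.1 hτ).2
    simp only [lowDegree, mem_filter, mem_univ, true_and, not_le, ex] at h0 h1 ⊢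
    have hsum : ∑ t, e 0 (τ t) + ∑ t, e 1 (τ t) + ∑ t, e 2 (τ t) ≤ (q - 1) * n := by
      rw [← sum_add_distrib, ← sum_add_distrib]
      refine (sum_le_sum fun t _ => he (τ t)).trans ?_
      simp [mul_comm]
    omega
  have hsplit : ∀ G : (Fin n → J) → F,
      ∑ τ, G τ = ∑ τ ∈ T0, G τ + ∑ τ ∈ T1, G τ + ∑ τ ∈ T2, G τ := by
    intro G
    rw [← sum_filter_add_sum_filter_not univ (fun τ => ex 0 τ ∈ lowDegree q n), add_assoc,
      ← sum_filter_add_sum_filter_not (univ.filter fun τ => ¬ ex 0 τ ∈ lowDegree q n)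
        (fun τ => ex 1 τ ∈ lowDegree q n), filter_filter, filter_filter]
  have := card_le_of_diagonal_eq_sum_slices (ι := S) (M := lowDegree q n)
    (fun α x => mon α x.1)
    (fun α y z => ∑ τ ∈ T0 with ex 0 τ = α, cf τ * (mon (ex 1 τ) y * mon (ex 2 τ) z))
    (fun α x z => ∑ τ ∈ T1 with ex 1 τ = α, cf τ * (mon (ex 0 τ) x * mon (ex 2 τ) z))
    (fun α x y => ∑ τ ∈ T2 with ex 2 τ = α, cf τ * (mon (ex 0 τ) x * mon (ex 1 τ) y))
    (fun x y z => by
      rw [hind, hexp, hsplit]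
      have e0 := sum_mul_eq_sum_fiberwise (T := T0) (s := lowDegree q n) (m := ex 0)
        (fun τ hτ => (mem_filter.1 hτ).2) (fun α => mon α x)
        (fun τ => cf τ * (mon (ex 1 τ) y * mon (ex 2 τ) z))
      have e1 := sum_mul_eq_sum_fiberwise (T := T1) (s := lowDegree q n) (m := ex 1)
        (fun τ hτ => (mem_filter.1 hτ).2.2) (fun α => mon α y)
        (fun τ => cf τ * (mon (ex 0 τ) x * mon (ex 2 τ) z))
      have e2 := sum_mul_eq_sum_fiberwise (T := T2) (s := lowDegree q n) (m := ex 2)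
        h2 (fun α => mon α z)
        (fun τ => cf τ * (mon (ex 0 τ) x * mon (ex 1 τ) y))
      rw [← e0, ← e1, ← e2]
      congr 1
      · congr 1
        · exact sum_congr rfl fun τ _ => by ring
        · exact sum_congr rfl fun τ _ => by ring
      · exact sum_congr rfl fun τ _ => by ring)
  simpa using this

/-! ### Exponentially few monomials have low degree. -/

/-- Both sides equal `q` at `u = 1`. There the right side has derivative `q (q - 1)` and the left
side `3 q (q - 1) / 2`, so the inequality holds slightly to the left of `1`. -/
theorem exists_card_mul_pow_gt_sum (q : ℕ) (hq : 2 ≤ q) :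
    ∃ u : ℝ, 0 < u ∧ u < 1 ∧ ∑ i : Fin q, u ^ (3 * (i : ℕ)) < q * u ^ (q - 1) := by
  let f : ℝ → ℝ := fun u => q * u ^ (q - 1) - ∑ i ∈ range q, u ^ (3 * i)
  have hderiv : HasDerivAt f (q * (((q - 1 : ℕ) : ℝ) * 1 ^ (q - 1 - 1)) -
      ∑ i ∈ range q, ((3 * i : ℕ) : ℝ) * 1 ^ (3 * i - 1)) 1 :=
    ((hasDerivAt_pow (q - 1) (1 : ℝ)).const_mul _).sub
      (HasDerivAt.fun_sum fun i _ => hasDerivAt_pow (3 * i) (1 : ℝ))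
  have hval : (q * (((q - 1 : ℕ) : ℝ) * 1 ^ (q - 1 - 1)) -
      ∑ i ∈ range q, ((3 * i : ℕ) : ℝ) * 1 ^ (3 * i - 1)) < 0 := by
    have hs : (∑ i ∈ range q, (i : ℝ)) * 2 = q * (q - 1 : ℕ) := by
      have h := sum_range_id_mul_two q
      rw [← Nat.cast_mul, ← h]
      push_cast
      rfl
    have hpos : (0 : ℝ) < q * (q - 1 : ℕ) := by
      have : 0 < q * (q - 1) := Nat.mul_pos (by omega) (by omega)
      exact_mod_cast this
    simp only [one_pow, mul_one, Nat.cast_mul, Nat.cast_ofNat, ← mul_sum]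
    linarith
  have hf1 : f 1 = 0 := by simp [f]
  have hslope := (hasDerivAt_iff_tendsto_slope.1 hderiv).eventually_lt_const hval
  have hleft : ∀ᶠ u in nhdsWithin (1 : ℝ) (Set.Iio 1), slope f 1 u < 0 :=
    hslope.filter_mono (nhdsWithin_mono _ fun u hu => ne_of_lt hu)
  have hpos : ∀ᶠ u in nhdsWithin (1 : ℝ) (Set.Iio 1), 0 < u :=
    (lt_mem_nhds one_pos).filter_mono nhdsWithin_le_nhds
  obtain ⟨u, ⟨hu, hu0⟩, hu1⟩ := ((hleft.and hpos).and self_mem_nhdsWithin).exists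
  refine ⟨u, hu0, hu1, ?_⟩
  have hu1' : u - 1 < 0 := sub_neg.2 hu1
  rw [slope_def_field, hf1, sub_zero, div_neg_iff] at hu
  have hfu : 0 < f u := by
    rcases hu with h | h
    · exact h.1
    · exact absurd h.2 (not_lt.2 hu1'.le)
  rw [Fin.sum_univ_eq_sum_range (fun i => u ^ (3 * i))]
  exact sub_pos.1 hfu

/-- A Chernoff bound: giving `α` the weight `u ^ (3 * ∑ α t)`, every low-degree exponent vector
weighs at least `u ^ ((q - 1) * n)`, and the total weight is an `n`-th power. -/
theorem exists_card_lowDegree_le (q : ℕ) (hq : 2 ≤ q) :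
    ∃ η : ℝ, 0 < η ∧ ∀ n : ℕ, (#(lowDegree q n) : ℝ) ≤ (q : ℝ) ^ ((1 - η) * n) := by
  obtain ⟨u, hu0, hu1, hu⟩ := exists_card_mul_pow_gt_sum q hq
  set s : ℝ := ∑ i : Fin q, u ^ (3 * (i : ℕ)) with hs
  have : Nonempty (Fin q) := ⟨⟨0, by omega⟩⟩
  have hs0 : 0 < s := sum_pos (fun i _ => by positivity) univ_nonempty
  have hp : 0 < u ^ (q - 1) := by positivity
  have hq1 : (1 : ℝ) < q := by exact_mod_cast hq
  have hg0 : 0 < s / u ^ (q - 1) := by positivity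
  have hgq : s / u ^ (q - 1) < q := by rwa [div_lt_iff₀ hp]
  -- Chosen so that `q ^ (1 - η) = s / u ^ (q - 1)`.
  refine ⟨1 - Real.logb q (s / u ^ (q - 1)), ?_, fun n => ?_⟩
  · rw [sub_pos, Real.logb_lt_iff_lt_rpow hq1 hg0, Real.rpow_one]
    exact hgq
  · rw [sub_sub_cancel, Real.rpow_mul (by positivity), Real.rpow_logb (by positivity) hq1.ne' hg0,
      Real.rpow_natCast, div_pow, le_div_iff₀ (by positivity), hs, Fintype.sum_pow, ← nsmul_eq_mul]
    calc #(lowDegree q n) • (u ^ (q - 1)) ^ n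
        ≤ ∑ α ∈ lowDegree q n, ∏ t, u ^ (3 * (α t : ℕ)) := by
          refine card_nsmul_le_sum _ _ _ fun α hα => ?_
          rw [prod_pow_eq_pow_sum, ← mul_sum, ← pow_mul]
          exact pow_le_pow_of_le_one hu0.le hu1.le (mem_filter.1 hα).2
      _ ≤ ∑ α : Fin n → Fin q, ∏ t, u ^ (3 * (α t : ℕ)) :=
          sum_le_sum_of_subset_of_nonneg (subset_univ _) fun α _ _ =>
            prod_nonneg fun t _ => by positivity

/-! ### Supersaturation for three-term equations. -/

/-- The pairs in `S` whose affine combination with weights proportional to `a`, `b` is in `S`. -/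
def affinePairs {F V : Type*} [Field F] [AddCommGroup V] [Module F V] [DecidableEq V] (a b : F)
    (S : Finset V) : Finset (V × V) :=
  (S ×ˢ S).filter fun p => (a + b)⁻¹ • (a • p.1 + b • p.2) ∈ S

/-- All fibres of a surjective homomorphism have the same size. Applied to evaluation of affine
maps, this says that a random affine map sends a point, or a pair of distinct points, to a uniformly
distributed image. -/
theorem card_filter_map_mem_mul_card {G H : Type*} [AddGroup G] [AddGroup H] [Fintype G]
    [Fintype H] [DecidableEq H] (f : G →+ H) (hf : Function.Surjective f) (P : Finset H) :
    #{g | f g ∈ P} * Fintype.card H = #P * Fintype.card G := by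
  have hfib : ∀ y, #{g | f g = y} = #{g | f g = 0} := fun y =>
    AddMonoidHom.card_fiber_eq_of_mem_range f (hf y) (hf 0)
  have hG : Fintype.card G = Fintype.card H * #{g | f g = 0} := by
    rw [← card_univ, card_eq_sum_card_fiberwise (f := f) (t := univ) (fun _ _ => mem_univ _),
      sum_congr rfl fun y _ => hfib y, sum_const, card_univ, smul_eq_mul]
  have hP : #{g | f g ∈ P} = #P * #{g | f g = 0} := by
    rw [card_eq_sum_card_fiberwise (f := f) (t := P) (fun g hg => by simpa using hg),
      sum_congr rfl (g := fun _ => #{g | f g = 0}), sum_const, smul_eq_mul]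
    intro y hy
    rw [← hfib y, filter_filter]
    congr 1
    ext g
    simp only [mem_filter, mem_univ, true_and, and_iff_right_iff_imp]
    rintro rfl
    exact hy
  rw [hP, hG]
  ring

section

variable {F : Type*} [Field F] {a b : F}

/-- Evaluation of an affine map from `F^d` to `F^n` at a point. -/
def affineEval (n : ℕ) {d : ℕ} (u : Fin d → F) :
    (Matrix (Fin n) (Fin d) F × (Fin n → F)) →+ (Fin n → F) where
  toFun M := M.1.mulVec u + M.2
  map_zero' := by simp
  map_add' M N := by
    simp only [Prod.fst_add, Prod.snd_add, Matrix.add_mulVec]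
    abel

theorem affineEval_surjective (n : ℕ) {d : ℕ} (u : Fin d → F) :
    Function.Surjective (affineEval n u) := fun x => ⟨(0, x), by simp [affineEval]⟩

theorem affineEval_prod_surjective [DecidableEq F] (n : ℕ) {d : ℕ} {u v : Fin d → F} (huv : u ≠ v) :
    Function.Surjective ((affineEval n u).prod (affineEval n v)) := by
  rintro ⟨x, y⟩
  obtain ⟨i, hi⟩ : ∃ i, u i - v i ≠ 0 := by
    by_contra! h
    exact huv (funext fun i => sub_eq_zero.1 (h i))
  -- A rank-one matrix sending `u - v` to `x - y`; the translation part then adjusts the value at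
  -- `u`.
  let M : Matrix (Fin n) (Fin d) F :=
    Matrix.vecMulVec (x - y) (Pi.single i (u i - v i)⁻¹)
  have hM : M.mulVec u - M.mulVec v = x - y := by
    rw [← Matrix.mulVec_sub, Matrix.vecMulVec_mulVec, single_dotProduct, Pi.sub_apply,
      inv_mul_cancel₀ hi]
    simp
  refine ⟨(M, x - M.mulVec u), ?_⟩
  simp only [AddMonoidHom.prod_apply, affineEval, AddMonoidHom.coe_mk, ZeroHom.coe_mk,
    Prod.mk.injEq]
  constructor
  · abel
  · rw [add_sub, add_comm, add_sub_assoc, ← neg_sub (M.mulVec u), hM]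
    abel

theorem affineEval_affine (hab : a + b ≠ 0) {n d : ℕ} (u v : Fin d → F)
    (M : Matrix (Fin n) (Fin d) F × (Fin n → F)) :
    affineEval n ((a + b)⁻¹ • (a • u + b • v)) M =
      (a + b)⁻¹ • (a • affineEval n u M + b • affineEval n v M) := by
  simp only [affineEval, AddMonoidHom.coe_mk, ZeroHom.coe_mk, Matrix.mulVec_smul,
    Matrix.mulVec_add]
  have : a • (M.1.mulVec u + M.2) + b • (M.1.mulVec v + M.2) =
      (a • M.1.mulVec u + b • M.1.mulVec v) + (a + b) • M.2 := by
    module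
  rw [this, smul_add, smul_add, inv_smul_smul₀ hab, smul_add]

variable [Fintype F] [DecidableEq F]

/-- As long as `S` exceeds the slice rank bound it contains a nontrivial pair. Deleting the first
point of that pair costs one element and destroys at least one pair. -/
theorem card_le_add_card_affinePairs (hab : a + b ≠ 0) {n : ℕ} (S : Finset (Fin n → F)) :
    #S ≤ 3 * #(lowDegree (Fintype.card F) n) + #{p ∈ affinePairs a b S | p.1 ≠ p.2} := by
  induction hs : #S using Nat.strong_induction_on generalizing S with
  | _ s ih =>
    subst hs
    by_cases hle : #S ≤ 3 * #(lowDegree (Fintype.card F) n)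
    · omega
    have hex : ∃ x ∈ S, ∃ y ∈ S, ∃ z ∈ S, a • x + b • y + (-(a + b)) • z = 0 ∧ x ≠ y := by
      by_contra! h
      exact hle (card_le_three_mul_card_lowDegree (neg_ne_zero.2 hab) (by ring) S h)
    obtain ⟨x, hx, y, hy, z, hz, h0, hxy⟩ := hex
    have hcard := card_erase_of_mem hx
    have hpos : 0 < #S := card_pos.2 ⟨x, hx⟩
    have hih := ih #(S.erase x) (by omega) _ rfl
    have hp : (x, y) ∈ ({p ∈ affinePairs a b S | p.1 ≠ p.2} : Finset _) := by
      have hz' : (a + b)⁻¹ • (a • x + b • y) = z := by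
        rw [neg_smul, add_neg_eq_zero] at h0
        rw [h0, inv_smul_smul₀ hab]
      simp only [affinePairs, mem_filter, mem_product]
      exact ⟨⟨⟨hx, hy⟩, hz'.symm ▸ hz⟩, hxy⟩
    have hsub : ({p ∈ affinePairs a b (S.erase x) | p.1 ≠ p.2} : Finset _) ⊆
        ({p ∈ affinePairs a b S | p.1 ≠ p.2} : Finset _).erase (x, y) := by
      rintro ⟨u, v⟩ huv
      simp only [affinePairs, mem_filter, mem_product, mem_erase] at huv ⊢
      obtain ⟨⟨⟨⟨h1, h2⟩, -, h3⟩, -, h4⟩, h5⟩ := huv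
      exact ⟨fun h => h1 (Prod.ext_iff.1 h).1, ⟨⟨h2, h3⟩, h4⟩, h5⟩
    have hc := card_le_card hsub
    rw [card_erase_of_mem hp] at hc
    have : 0 < #({p ∈ affinePairs a b S | p.1 ≠ p.2} : Finset _) := card_pos.2 ⟨_, hp⟩
    omega

/-- Averaging the bound of `card_le_add_card_affinePairs` over all affine maps `F^d → F^n`. -/
theorem card_pow_mul_card_le (hab : a + b ≠ 0) {n : ℕ} (d : ℕ) (S : Finset (Fin n → F)) :
    Fintype.card F ^ (d + n) * #S ≤
      3 * #(lowDegree (Fintype.card F) d) * Fintype.card F ^ (2 * n) +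
        Fintype.card F ^ (2 * d) * #(affinePairs a b S) := by
  set q := Fintype.card F
  let Φ := Matrix (Fin n) (Fin d) F × (Fin n → F)
  let pre : Φ → Finset (Fin d → F) := fun M => {u | affineEval n u M ∈ S}
  have hΦ : 0 < Fintype.card Φ := Fintype.card_pos
  have hone : (∑ M : Φ, #(pre M)) * q ^ n = q ^ d * (#S * Fintype.card Φ) := by
    have h : ∑ M : Φ, #(pre M) = ∑ u : Fin d → F, #{M : Φ | affineEval n u M ∈ S} := by
      simp_rw [pre, card_filter]
      rw [sum_comm]
    have hc : Fintype.card (Fin n → F) = q ^ n := by simp [q]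
    rw [h, sum_mul, sum_congr rfl fun u _ => ?_, sum_const, card_univ, smul_eq_mul]
    · congr 1
      simp [q]
    · rw [← hc]
      exact card_filter_map_mem_mul_card _ (affineEval_surjective n u) S
  have htwo : (∑ M : Φ, #{p ∈ affinePairs a b (pre M) | p.1 ≠ p.2}) * q ^ (2 * n) ≤
      q ^ (2 * d) * (#(affinePairs a b S) * Fintype.card Φ) := by
    have h : ∑ M : Φ, #{p ∈ affinePairs a b (pre M) | p.1 ≠ p.2} =
        ∑ p : (Fin d → F) × (Fin d → F) with p.1 ≠ p.2,
          #{M : Φ | ((affineEval n p.1).prod (affineEval n p.2)) M ∈ affinePairs a b S} := by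
      simp_rw [card_filter]
      rw [sum_comm]
      refine sum_congr rfl fun M _ => ?_
      rw [← sum_filter, ← sum_filter]
      refine sum_congr ?_ fun _ _ => rfl
      ext p
      simp only [affinePairs, pre, mem_filter, mem_product, mem_univ, true_and,
        AddMonoidHom.prod_apply, affineEval_affine hab]
      tauto
    have hc : Fintype.card ((Fin n → F) × (Fin n → F)) = q ^ (2 * n) := by
      simp [q, two_mul, pow_add]
    rw [h, sum_mul, sum_congr rfl fun p hp => ?_, sum_const, smul_eq_mul]
    · refine Nat.mul_le_mul_right _ ((card_le_univ _).trans ?_)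
      simp [q, two_mul, pow_add]
    · rw [← hc]
      exact card_filter_map_mem_mul_card _
        (affineEval_prod_surjective n (mem_filter.1 hp).2) _
  have hsum : ∑ M : Φ, #(pre M) ≤ Fintype.card Φ * (3 * #(lowDegree q d)) +
      ∑ M : Φ, #{p ∈ affinePairs a b (pre M) | p.1 ≠ p.2} := by
    refine (sum_le_sum fun M _ => card_le_add_card_affinePairs hab (pre M)).trans ?_
    rw [sum_add_distrib, sum_const, card_univ, smul_eq_mul]
  refine Nat.le_of_mul_le_mul_left ?_ hΦ
  calc Fintype.card Φ * (q ^ (d + n) * #S)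
      = (∑ M : Φ, #(pre M)) * q ^ n * q ^ n := by rw [hone]; ring
    _ ≤ (Fintype.card Φ * (3 * #(lowDegree q d)) +
        ∑ M : Φ, #{p ∈ affinePairs a b (pre M) | p.1 ≠ p.2}) * q ^ n * q ^ n := by gcongr
    _ = Fintype.card Φ * (3 * #(lowDegree q d)) * q ^ (2 * n) +
        (∑ M : Φ, #{p ∈ affinePairs a b (pre M) | p.1 ≠ p.2}) * q ^ (2 * n) := by ring
    _ ≤ Fintype.card Φ * (3 * #(lowDegree q d)) * q ^ (2 * n) +
        q ^ (2 * d) * (#(affinePairs a b S) * Fintype.card Φ) := by gcongr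
    _ = _ := by ring

/-- The dimension `d` in `card_pow_mul_card_le` is taken to be a small multiple of `n`: large enough
for the low-degree term to be negligible, small enough for the loss `q ^ (2 * d)` to be affordable.
-/
theorem exists_le_card_affinePairs (hab : a + b ≠ 0) {ε : ℝ} (hε : 0 < ε) :
    ∃ δ : ℝ, 0 < δ ∧ ∃ n₀ : ℕ, ∀ n ≥ n₀, ∀ S : Finset (Fin n → F),
      (Fintype.card F : ℝ) ^ ((1 - δ) * n) ≤ #S →
        (Fintype.card F : ℝ) ^ ((2 - ε) * n) ≤ #(affinePairs a b S) := by
  have hq2 : 2 ≤ Fintype.card F := Fintype.one_lt_card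
  obtain ⟨η, hη, hlow⟩ := exists_card_lowDegree_le (Fintype.card F) hq2
  set q : ℝ := (Fintype.card F : ℝ) with hq
  have hq2' : (2 : ℝ) ≤ q := by
    rw [hq]
    exact_mod_cast hq2
  have hq1 : (1 : ℝ) ≤ q := by linarith
  have hq0 : (0 : ℝ) < q := by linarith
  have hκ : 0 < 1 + 1 / η := by positivity
  -- This `δ` makes the part of the loss linear in `n`, namely `(δ + δ / η) * n`, equal to `ε / 2 *
  -- n`; the bound on `n` lets the other half of `ε * n` absorb the constants.
  refine ⟨ε / (2 * (1 + 1 / η)), by positivity, ⌈2 * (3 / η + 2) / ε⌉₊, fun n hn S hS => ?_⟩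
  set δ : ℝ := ε / (2 * (1 + 1 / η)) with hδ
  have hδε : δ + δ / η = ε / 2 := by
    rw [hδ]
    field_simp
  have hn' : 3 / η + 2 ≤ ε / 2 * n := by
    have := Nat.ceil_le.1 hn
    rw [div_le_iff₀ hε] at this
    linarith
  -- The condition `δ * n + 3 ≤ η * d` is what makes the low-degree term at most half of the left
  -- side; the `3` pays for the factor `6 ≤ q ^ 3`.
  set d : ℕ := ⌈(δ * n + 3) / η⌉₊ with hd
  have hd1 : δ * n + 3 ≤ η * d := by
    have := Nat.le_ceil ((δ * n + 3) / η)
    rw [div_le_iff₀ hη] at this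
    linarith
  have hd2 : (d : ℝ) ≤ δ / η * n + 3 / η + 1 := by
    have := (Nat.ceil_lt_add_one (a := (δ * n + 3) / η) (by positivity)).le
    calc (d : ℝ) ≤ (δ * n + 3) / η + 1 := this
      _ = _ := by ring
  have hmain : q ^ (d + n) * (#S : ℝ) ≤
      3 * (#(lowDegree (Fintype.card F) d) : ℝ) * q ^ (2 * n) +
        q ^ (2 * d) * (#(affinePairs a b S) : ℝ) := by
    have := card_pow_mul_card_le hab d S
    rw [hq]
    exact_mod_cast this
  have hsmall : 2 * (3 * (#(lowDegree (Fintype.card F) d) : ℝ) * q ^ (2 * n)) ≤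
      q ^ (d + n) * (#S : ℝ) := by
    calc 2 * (3 * (#(lowDegree (Fintype.card F) d) : ℝ) * q ^ (2 * n))
        ≤ 6 * q ^ ((1 - η) * d) * q ^ (2 * n) := by
          have := mul_le_mul_of_nonneg_right (hlow d) (by positivity : 0 ≤ 6 * q ^ (2 * n))
          linarith
      _ ≤ q ^ (3 : ℝ) * q ^ ((1 - η) * d) * q ^ (2 * n) := by
          gcongr
          have : (2 : ℝ) ^ 3 ≤ q ^ 3 := by gcongr
          rw [show (3 : ℝ) = ((3 : ℕ) : ℝ) by norm_num, Real.rpow_natCast]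
          linarith
      _ = q ^ (3 + (1 - η) * d + 2 * n) := by
          rw [Real.rpow_add hq0, Real.rpow_add hq0, ← Real.rpow_natCast q (2 * n)]
          push_cast
          rfl
      _ ≤ q ^ ((d + n) + (1 - δ) * n) := by
          refine Real.rpow_le_rpow_of_exponent_le hq1 ?_
          linarith
      _ = q ^ (d + n) * q ^ ((1 - δ) * n) := by
          rw [Real.rpow_add hq0, ← Real.rpow_natCast q (d + n)]
          push_cast
          rfl
      _ ≤ _ := by gcongr
  have hpairs : q ^ (d + n) * (#S : ℝ) ≤ 2 * (q ^ (2 * d) * (#(affinePairs a b S) : ℝ)) := by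
    linarith
  have hexp : q ^ ((2 - ε) * n) * (2 * q ^ (2 * d)) ≤ q ^ (d + n) * (#S : ℝ) := by
    calc q ^ ((2 - ε) * n) * (2 * q ^ (2 * d))
        ≤ q ^ ((2 - ε) * n) * (q ^ (1 : ℝ) * q ^ (2 * d)) := by
          rw [Real.rpow_one]
          gcongr
      _ = q ^ ((2 - ε) * n + (1 + 2 * d)) := by
          rw [Real.rpow_add hq0, Real.rpow_add hq0, ← Real.rpow_natCast q (2 * d)]
          push_cast
          rfl
      _ ≤ q ^ ((d + n) + (1 - δ) * n) := by
          refine Real.rpow_le_rpow_of_exponent_le hq1 ?_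
          have : (δ + δ / η) * n = ε / 2 * n := by rw [hδε]
          linarith
      _ = q ^ (d + n) * q ^ ((1 - δ) * n) := by
          rw [Real.rpow_add hq0, ← Real.rpow_natCast q (d + n)]
          push_cast
          rfl
      _ ≤ _ := by gcongr
  have hp : 0 < 2 * q ^ (2 * d) := by positivity
  refine le_of_mul_le_mul_right ?_ hp
  linarith

end

/-! ### Collisions and representation counts. -/

/-- Cauchy–Schwarz on the fibre sizes of `f`, whose squares count the collisions. -/
theorem sq_card_le_card_mul_sum_ite {α β : Type*} [Fintype β] [DecidableEq β] (A : Finset α)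
    (f : α → β) :
    #A ^ 2 ≤ Fintype.card β * ∑ x ∈ A, ∑ y ∈ A, (if f x = f y then 1 else 0 : ℕ) := by
  have h : ∑ x ∈ A, ∑ y ∈ A, (if f x = f y then 1 else 0 : ℕ) =
      ∑ b : β, (∑ x ∈ A, (if f x = b then 1 else 0 : ℕ)) ^ 2 := by
    simp_rw [sq, sum_mul_sum]
    conv_rhs => rw [sum_comm]
    refine sum_congr rfl fun x _ => ?_
    conv_rhs => rw [sum_comm]
    refine sum_congr rfl fun y _ => ?_
    simp [eq_comm]
  have hA : #A = ∑ b : β, ∑ x ∈ A, (if f x = b then 1 else 0 : ℕ) := by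
    rw [sum_comm]
    simp
  rw [h, hA]
  exact sq_sum_le_card_mul_sum_sq

theorem one_lt_card_real (F : Type*) [Field F] [Fintype F] : (1 : ℝ) < Fintype.card F := by
  exact_mod_cast Fintype.one_lt_card

theorem exists_le_of_card_mul_le_sum {F : Type*} [Field F] [Fintype F] {n : ℕ}
    {S : Finset (Fin n → F)} (hS : S.Nonempty)
    (g : (Fin n → F) → ℕ) {t : ℝ}
    (h : (Fintype.card F : ℝ) ^ ((1 + t) * n) ≤ ∑ z ∈ S, (g z : ℝ)) :
    ∃ z ∈ S, (Fintype.card F : ℝ) ^ (t * n) ≤ g z := by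
  refine exists_le_of_sum_le hS ?_
  refine le_trans ?_ h
  rw [sum_const, nsmul_eq_mul, add_mul, one_mul,
    Real.rpow_add (zero_lt_one.trans (one_lt_card_real F)), Real.rpow_natCast]
  gcongr
  have := card_le_univ S
  rw [Fintype.card_fun, Fintype.card_fin] at this
  exact_mod_cast this

theorem nonempty_of_rpow_le {F : Type*} [Field F] [Fintype F] {n : ℕ} {S : Finset (Fin n → F)} {t : ℝ}
    (hS : (Fintype.card F : ℝ) ^ t ≤ #S) : S.Nonempty := by
  rw [← card_pos]
  exact_mod_cast (Real.rpow_pos_of_pos (zero_lt_one.trans (one_lt_card_real F)) t).trans_le hS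

/-- The number of ways to write `y` as `∑ aᵢ • xᵢ` with `xᵢ ∈ S`, for a list of weights `aᵢ`. -/
def repCount {F V : Type*} [Field F] [AddCommGroup V] [Module F V] [DecidableEq V]
    (S : Finset V) : List F → V → ℕ
  | [], y => if y = 0 then 1 else 0
  | a :: l, y => ∑ x ∈ S, repCount S l (y - a • x)

section

variable {F V : Type*} [Field F] [AddCommGroup V] [Module F V] [DecidableEq V]

theorem repCount_mono {S T : Finset V} (h : T ⊆ S) (l : List F) (y : V) :
    repCount T l y ≤ repCount S l y := by
  induction l generalizing y with
  | nil => exact le_rfl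
  | cons a l ih =>
    exact (sum_le_sum fun x _ => ih _).trans (sum_le_sum_of_subset h)

theorem repCount_append [Fintype V] (S : Finset V) (l l' : List F) (y : V) :
    repCount S (l ++ l') y = ∑ w, repCount S l w * repCount S l' (y - w) := by
  induction l generalizing y with
  | nil => simp [repCount]
  | cons a l ih =>
    simp only [List.cons_append, repCount, ih, sum_mul]
    rw [sum_comm (s := univ)]
    refine sum_congr rfl fun x _ => ?_
    refine Fintype.sum_equiv (Equiv.addRight (a • x)) _ _ fun w => ?_
    simp only [Equiv.coe_addRight, add_sub_cancel_right]
    congr 2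
    abel

/-- Keeping only the partial sums of the form `c • z` with `z ∈ T`, which are distinct for distinct
`z`. With `c = l.sum` this is the substitution of `l` for a single weight. -/
theorem sum_repCount_mul_le_repCount_append [Fintype V] {S T : Finset V} {c : F} (hc : c ≠ 0)
    (l l' : List F) (y : V) :
    ∑ z ∈ T, repCount S l (c • z) * repCount S l' (y - c • z) ≤ repCount S (l ++ l') y := by
  rw [repCount_append, ← sum_image (s := T) (g := fun z => c • z)
    (f := fun w => repCount S l w * repCount S l' (y - w))
    ((smul_right_injective V hc).injOn)]
  exact sum_le_sum_of_subset (subset_univ _)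

theorem repCount_append_comm [Fintype V] (S : Finset V) (l l' : List F) (y : V) :
    repCount S (l ++ l') y = repCount S (l' ++ l) y := by
  rw [repCount_append, repCount_append]
  refine Fintype.sum_equiv (Equiv.subLeft y) _ _ fun w => ?_
  simp [mul_comm]

theorem sum_repCount_pair {a b : F} (hab : a + b ≠ 0) (S : Finset V) :
    ∑ z ∈ S, repCount S [a, b] ((a + b) • z) = #(affinePairs a b S) := by
  simp only [repCount, affinePairs, card_filter, sum_product]
  rw [sum_comm]
  refine sum_congr rfl fun x _ => ?_
  rw [sum_comm]
  refine sum_congr rfl fun y _ => ?_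
  rw [← sum_ite_eq' S ((a + b)⁻¹ • (a • x + b • y)) fun _ => 1]
  refine sum_congr rfl fun z _ => ?_
  refine if_congr ?_ rfl rfl
  rw [sub_sub, sub_eq_zero, eq_inv_smul_iff₀ hab]

/-- A collision `s • z + a • w = s • x + a • y` of the map `(x, y) ↦ s • x + a • y` is a
representation of `s • z` with weights `s, a, -a`. -/
theorem card_pow_four_le [Fintype V] (s a : F) (S : Finset V) :
    #S ^ 4 ≤ Fintype.card V * ∑ z ∈ S, repCount S [s, a, -a] (s • z) := by
  have h := sq_card_le_card_mul_sum_ite (S ×ˢ S) fun p : V × V => s • p.1 + a • p.2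
  have h4 : #S ^ 4 = #(S ×ˢ S) ^ 2 := by
    rw [card_product]
    ring
  rw [h4]
  refine h.trans_eq ?_
  congr 1
  simp only [repCount, sum_product]
  refine sum_congr rfl fun z _ => ?_
  rw [sum_comm]
  refine sum_congr rfl fun x _ => ?_
  rw [sum_comm]
  refine sum_congr rfl fun y _ => ?_
  refine sum_congr rfl fun w _ => ?_
  refine if_congr ?_ rfl rfl
  rw [← sub_eq_zero]
  have : s • z + a • w - (s • x + a • y) = s • z - s • x - a • y - -a • w := by
    rw [neg_smul]
    abel
  rw [this]

end

/-! ### Popular elements for weights with nonzero sum. -/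

section

variable {F : Type*} [Field F] [Fintype F] [DecidableEq F]

/-- In every set `S` of nearly full exponential density there is an element `z` such that the
number of representations of `(∑ aᵢ) • z` as `∑ aᵢ • xᵢ` with `xᵢ ∈ S` is nearly maximal. -/
def IsPopular (l : List F) : Prop :=
  ∀ ε : ℝ, 0 < ε → ∃ δ : ℝ, 0 < δ ∧ ∃ n₀ : ℕ, ∀ n ≥ n₀, ∀ S : Finset (Fin n → F),
    (Fintype.card F : ℝ) ^ ((1 - δ) * n) ≤ #S →
      ∃ z ∈ S, (Fintype.card F : ℝ) ^ ((l.length - 1 - ε) * n) ≤ repCount S l (l.sum • z)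

theorem isPopular_singleton (a : F) : IsPopular [a] := by
  intro ε hε
  refine ⟨1, one_pos, 0, fun n _ S hS => ?_⟩
  have hpos : (0 : ℝ) < #S := lt_of_lt_of_le
    (Real.rpow_pos_of_pos (zero_lt_one.trans (one_lt_card_real F)) _) hS
  obtain ⟨z, hz⟩ := card_pos.1 (Nat.cast_pos.1 hpos)
  refine ⟨z, hz, ?_⟩
  have h1 : 1 ≤ repCount S [a] (a • z) := by
    simp only [repCount]
    refine le_trans ?_ (single_le_sum (fun _ _ => Nat.zero_le _) hz)
    simp
  calc (Fintype.card F : ℝ) ^ ((([a].length : ℕ) - 1 - ε) * n : ℝ) ≤ 1 := by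
        refine Real.rpow_le_one_of_one_le_of_nonpos (one_lt_card_real F).le ?_
        simp only [List.length_singleton, Nat.cast_one, sub_self, zero_sub]
        have : 0 ≤ ε * n := by positivity
        linarith
    _ ≤ _ := by
        simp only [List.sum_singleton]
        exact_mod_cast h1

theorem isPopular_pair {a b : F} (hab : a + b ≠ 0) : IsPopular [a, b] := by
  intro ε hε
  obtain ⟨δ, hδ, n₀, h⟩ := exists_le_card_affinePairs hab hε
  refine ⟨δ, hδ, n₀, fun n hn S hS => ?_⟩
  obtain ⟨z, hz, hle⟩ := exists_le_of_card_mul_le_sum (nonempty_of_rpow_le hS)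
    (fun z => repCount S [a, b] ((a + b) • z)) (t := 1 - ε) (by
      rw [← Nat.cast_sum, sum_repCount_pair hab]
      have := h n hn S hS
      rwa [show (1 + (1 - ε)) = 2 - ε by ring])
  refine ⟨z, hz, ?_⟩
  have h1 : ((([a, b] : List F).length : ℝ) - 1 - ε) = 1 - ε := by
    norm_num
  rw [h1]
  simpa using hle

theorem isPopular_triple (s a : F) : IsPopular [s, a, -a] := by
  intro ε hε
  refine ⟨ε / 4, by positivity, 0, fun n _ S hS => ?_⟩
  have hq := one_lt_card_real F
  have hq0 := zero_lt_one.trans hq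
  obtain ⟨z, hz, hle⟩ := exists_le_of_card_mul_le_sum (nonempty_of_rpow_le hS)
    (fun z => repCount S [s, a, -a] (s • z)) (t := 2 - ε) (by
      have h := card_pow_four_le s a S
      rw [Fintype.card_fun, Fintype.card_fin] at h
      have h' : (#S : ℝ) ^ 4 ≤ (Fintype.card F : ℝ) ^ n *
          ∑ z ∈ S, (repCount S [s, a, -a] (s • z) : ℝ) := by exact_mod_cast h
      have hp : (0 : ℝ) < (Fintype.card F : ℝ) ^ n := by positivity
      refine le_of_mul_le_mul_left ?_ hp
      refine le_trans ?_ h'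
      calc (Fintype.card F : ℝ) ^ n * (Fintype.card F : ℝ) ^ ((1 + (2 - ε)) * n)
          = ((Fintype.card F : ℝ) ^ ((1 - ε / 4) * n)) ^ 4 := by
            rw [← Real.rpow_natCast _ n, ← Real.rpow_add hq0, ← Real.rpow_mul_natCast hq0.le]
            congr 1
            push_cast
            ring
        _ ≤ _ := by gcongr)
  refine ⟨z, hz, ?_⟩
  have h1 : ((([s, a, -a] : List F).length : ℝ) - 1 - ε) = 2 - ε := by
    norm_num
  rw [h1]
  simpa using hle

/-- All elements of a large part of `S` are popular if there always is one popular element. -/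
theorem IsPopular.exists_subset {l : List F} (hl : IsPopular l) {ε η : ℝ} (hε : 0 < ε)
    (hη : 0 < η) :
    ∃ δ : ℝ, 0 < δ ∧ ∃ n₀ : ℕ, ∀ n ≥ n₀, ∀ S : Finset (Fin n → F),
      (Fintype.card F : ℝ) ^ ((1 - δ) * n) ≤ #S →
        ∃ T ⊆ S, (Fintype.card F : ℝ) ^ ((1 - η) * n) ≤ #T ∧
          ∀ z ∈ T, (Fintype.card F : ℝ) ^ ((l.length - 1 - ε) * n) ≤
            repCount S l (l.sum • z) := by
  classical
  obtain ⟨δ₁, hδ₁, n₁, h⟩ := hl ε hε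
  have hq := one_lt_card_real F
  have hq0 := zero_lt_one.trans hq
  -- The factor `1 / 2` leaves room: for `n ≥ 1 / δ` the size of `S` is at least `2 * q ^ ((1 - 2 *
  -- δ) * n)`, which covers the unpopular elements and the required `T` together.
  set δ := min η δ₁ / 2 with hδ
  have hδ0 : 0 < δ := by positivity
  have hδη : 2 * δ ≤ η := by
    have := min_le_left η δ₁
    linarith
  have hδδ : 2 * δ ≤ δ₁ := by
    have := min_le_right η δ₁
    linarith
  refine ⟨δ, hδ0, max n₁ ⌈1 / δ⌉₊, fun n hn S hS => ?_⟩
  have hn1 : 1 ≤ δ * n := by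
    have := Nat.ceil_le.1 ((le_max_right _ _).trans hn)
    rw [div_le_iff₀ hδ0] at this
    linarith
  let good : (Fin n → F) → Prop := fun z =>
    (Fintype.card F : ℝ) ^ ((l.length - 1 - ε) * n) ≤ repCount S l (l.sum • z)
  refine ⟨S.filter good, filter_subset _ _, ?_, fun z hz => (mem_filter.1 hz).2⟩
  -- The unpopular elements contain no element popular for their own set, since a popular one there
  -- would be popular in the larger set `S`.
  have hbad : (#(S.filter fun z => ¬ good z) : ℝ) < (Fintype.card F : ℝ) ^ ((1 - δ₁) * n) := by
    by_contra! hle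
    obtain ⟨z, hz, hz'⟩ := h n ((le_max_left _ _).trans hn) _ hle
    refine (mem_filter.1 hz).2 (hz'.trans ?_)
    exact_mod_cast repCount_mono (filter_subset (fun z => ¬ good z) S) l (l.sum • z)
  have hsum : (#(S.filter good) : ℝ) + #(S.filter fun z => ¬ good z) = #S := by
    exact_mod_cast card_filter_add_card_filter_not (s := S) good
  have hn0 : (0 : ℝ) ≤ n := Nat.cast_nonneg n
  have hmono1 : (Fintype.card F : ℝ) ^ ((1 - δ₁) * n) ≤
      (Fintype.card F : ℝ) ^ ((1 - 2 * δ) * n) := by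
    refine Real.rpow_le_rpow_of_exponent_le hq.le ?_
    gcongr
  have hmono2 : (Fintype.card F : ℝ) ^ ((1 - η) * n) ≤
      (Fintype.card F : ℝ) ^ ((1 - 2 * δ) * n) := by
    refine Real.rpow_le_rpow_of_exponent_le hq.le ?_
    gcongr
  have hdouble : 2 * (Fintype.card F : ℝ) ^ ((1 - 2 * δ) * n) ≤
      (Fintype.card F : ℝ) ^ ((1 - δ) * n) := by
    have h2 : (2 : ℝ) ≤ (Fintype.card F : ℝ) ^ (δ * n) := by
      calc (2 : ℝ) ≤ (Fintype.card F : ℝ) ^ (1 : ℝ) := by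
            rw [Real.rpow_one]
            exact_mod_cast Fintype.one_lt_card (α := F)
        _ ≤ _ := Real.rpow_le_rpow_of_exponent_le hq.le hn1
    calc 2 * (Fintype.card F : ℝ) ^ ((1 - 2 * δ) * n)
        ≤ (Fintype.card F : ℝ) ^ (δ * n) * (Fintype.card F : ℝ) ^ ((1 - 2 * δ) * n) := by gcongr
      _ = _ := by
        rw [← Real.rpow_add hq0]
        congr 1
        ring
  linarith

/-- If every element of a large part `T` of `S` is popular for `l`, then a popular element for a
list with one weight `l.sum` can be refined by substituting `l` for that weight. -/
theorem IsPopular.append {l l' : List F} (hl : IsPopular l) (hs : l.sum ≠ 0)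
    (hl' : IsPopular (l.sum :: l')) : IsPopular (l ++ l') := by
  intro ε hε
  obtain ⟨η, hη, n₁, h₁⟩ := hl' (ε / 2) (by positivity)
  obtain ⟨δ, hδ, n₂, h₂⟩ := hl.exists_subset (ε := ε / 2) (by positivity) hη
  refine ⟨δ, hδ, max n₁ n₂, fun n hn S hS => ?_⟩
  obtain ⟨T, hTS, hT, hpop⟩ := h₂ n ((le_max_right _ _).trans hn) S hS
  obtain ⟨z, hz, hle⟩ := h₁ n ((le_max_left _ _).trans hn) T hT
  refine ⟨z, hTS hz, ?_⟩
  have hq0 := zero_lt_one.trans (one_lt_card_real F)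
  set y := (l ++ l').sum • z with hy
  have hy' : (l.sum :: l').sum • z = y := by simp [hy]
  rw [hy'] at hle
  have hsum : (Fintype.card F : ℝ) ^ ((l.length - 1 - ε / 2) * n) * repCount T (l.sum :: l') y ≤
      repCount S (l ++ l') y := by
    calc (Fintype.card F : ℝ) ^ ((l.length - 1 - ε / 2) * n) * repCount T (l.sum :: l') y
        = ∑ w ∈ T, (Fintype.card F : ℝ) ^ ((l.length - 1 - ε / 2) * n) *
            repCount T l' (y - l.sum • w) := by
          rw [← mul_sum, repCount, Nat.cast_sum]
      _ ≤ ∑ w ∈ T, (repCount S l (l.sum • w) : ℝ) * repCount S l' (y - l.sum • w) := by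
          refine sum_le_sum fun w hw => ?_
          refine mul_le_mul (hpop w hw) ?_ (by positivity) (by positivity)
          exact_mod_cast repCount_mono hTS l' (y - l.sum • w)
      _ ≤ _ := by exact_mod_cast sum_repCount_mul_le_repCount_append hs l l' y
  refine le_trans ?_ hsum
  refine le_trans (le_of_eq ?_) (mul_le_mul_of_nonneg_left hle (by positivity))
  rw [← Real.rpow_add hq0]
  congr 1
  simp only [List.length_append, List.length_cons, Nat.cast_add, Nat.cast_one]
  ring

/-- Induction on the length. If the first two weights have nonzero sum, they are merged into one and
reinserted by `IsPopular.append`. If they cancel, the remaining list still has nonzero sum `s` and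
is substituted into `[s, a, -a]`. -/
theorem isPopular_of_sum_ne_zero (l : List F) (hl : l.sum ≠ 0) : IsPopular l := by
  induction hn : l.length using Nat.strong_induction_on generalizing l with
  | _ k ih =>
    subst hn
    match l, hl, ih with
    | [], hl, _ => exact absurd List.sum_nil hl
    | [a], _, _ => exact isPopular_singleton a
    | a :: b :: l, hl, ih =>
      by_cases hab : a + b = 0
      · have hb : b = -a := (neg_eq_of_add_eq_zero_right hab).symm
        subst hb
        have hl' : l.sum ≠ 0 := by simpa using hl
        have h : IsPopular (l ++ [a, -a]) :=
          (ih l.length (by simp) l hl' rfl).append hl' (isPopular_triple _ a)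
        intro ε hε
        obtain ⟨δ, hδ, n₀, h'⟩ := h ε hε
        refine ⟨δ, hδ, n₀, fun n hn S hS => ?_⟩
        obtain ⟨z, hz, hle⟩ := h' n hn S hS
        refine ⟨z, hz, ?_⟩
        rw [repCount_append_comm] at hle
        simpa [add_assoc, add_comm (2 : ℝ)] using hle
      · have hs : ([a, b] : List F).sum = a + b := by simp
        refine IsPopular.append (l := [a, b]) (l' := l) (isPopular_pair hab) (by rwa [hs]) ?_
        rw [hs]
        refine ih _ (by simp) ((a + b) :: l) ?_ rfl
        simpa [add_assoc] using hl

/-- Elements that are popular for several lists at once. -/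
theorem exists_subset_forall_popular (L : List (List F)) (hL : ∀ l ∈ L, l.sum ≠ 0) {ε η : ℝ}
    (hε : 0 < ε) (hη : 0 < η) :
    ∃ δ : ℝ, 0 < δ ∧ ∃ n₀ : ℕ, ∀ n ≥ n₀, ∀ S : Finset (Fin n → F),
      (Fintype.card F : ℝ) ^ ((1 - δ) * n) ≤ #S →
        ∃ T ⊆ S, (Fintype.card F : ℝ) ^ ((1 - η) * n) ≤ #T ∧
          ∀ z ∈ T, ∀ l ∈ L, (Fintype.card F : ℝ) ^ ((l.length - 1 - ε) * n) ≤
            repCount S l (l.sum • z) := by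
  induction L generalizing η with
  | nil => exact ⟨η, hη, 0, fun n _ S hS => ⟨S, Subset.rfl, hS, by simp⟩⟩
  | cons l L ih =>
    obtain ⟨δ₁, hδ₁, n₁, h₁⟩ :=
      (isPopular_of_sum_ne_zero l (hL l (by simp))).exists_subset hε hη
    obtain ⟨δ₂, hδ₂, n₂, h₂⟩ := ih (fun l hl => hL l (by simp [hl])) hδ₁
    refine ⟨δ₂, hδ₂, max n₁ n₂, fun n hn S hS => ?_⟩
    obtain ⟨T₂, hT₂S, hT₂, hpop₂⟩ := h₂ n ((le_max_right _ _).trans hn) S hS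
    obtain ⟨T₁, hT₁, hT₁card, hpop₁⟩ := h₁ n ((le_max_left _ _).trans hn) T₂ hT₂
    refine ⟨T₁, hT₁.trans hT₂S, hT₁card, fun z hz l' hl' => ?_⟩
    rcases List.mem_cons.1 hl' with rfl | hl'
    · refine (hpop₁ z hz).trans ?_
      exact_mod_cast repCount_mono hT₂S l' (l'.sum • z)
    · exact hpop₂ z (hT₁ hz) l' hl'

end

/-! ### Weights indexed by finite types. -/

/-- The families in `S` with weighted sum `y`, for weights indexed by a type. -/
abbrev WeightedRep {F V ι : Type*} [Field F] [AddCommGroup V] [Module F V] [Fintype ι]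
    (S : Finset V) (c : ι → F) (y : V) : Type _ :=
  {x : ι → V // (∀ j, x j ∈ S) ∧ ∑ j, c j • x j = y}

/-- Transfers the results on lists, where induction is convenient, to the index types given by
column classes. -/
theorem exists_list_repCount_eq {F : Type*} [Field F] [DecidableEq F] {ι : Type*} [Fintype ι] (c : ι → F) :
    ∃ l : List F, l.sum = ∑ j, c j ∧ l.length = Fintype.card ι ∧
      ∀ (n : ℕ) (S : Finset (Fin n → F)) (y : Fin n → F), repCount S l y = Nat.card (WeightedRep S c y) := by
  revert c
  refine Fintype.induction_empty_option (P := fun ι _ => ∀ c : ι → F,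
    ∃ l : List F, l.sum = ∑ j, c j ∧ l.length = Fintype.card ι ∧
      ∀ (n : ℕ) (S : Finset (Fin n → F)) (y : Fin n → F), repCount S l y = Nat.card (WeightedRep S c y)) ?_ ?_ ?_ ι
  · intro α β _ e ih c
    let _ : Fintype α := Fintype.ofEquiv β e.symm
    obtain ⟨l, hsum, hlen, hl⟩ := ih (c ∘ e)
    refine ⟨l, ?_, ?_, fun n S y => ?_⟩
    · rw [hsum]
      exact Fintype.sum_equiv e _ _ fun _ => rfl
    · rw [hlen]
      exact Fintype.card_congr e
    · rw [hl]
      refine Nat.card_congr ((e.arrowCongr (Equiv.refl (Fin n → F))).subtypeEquiv fun x => ?_)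
      refine and_congr ⟨fun h j => h _, fun h j => ?_⟩ ?_
      · simpa using h (e j)
      · refine Eq.congr_left (Fintype.sum_equiv e _ _ fun j => ?_)
        simp
  · intro c
    refine ⟨[], by simp, by simp, fun n S y => ?_⟩
    by_cases hy : y = 0
    · subst hy
      have : Unique (WeightedRep S c (0 : Fin n → F)) :=
        { default := ⟨fun j => j.elim, fun j => j.elim, by simp⟩
          uniq := fun x => Subtype.ext (funext fun j => j.elim) }
      simp [repCount]
    · have : IsEmpty (WeightedRep S c y) :=
        ⟨fun x => hy (by simpa using x.2.2.symm)⟩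
      simp [repCount, hy]
  · intro α _ ih c
    obtain ⟨l, hsum, hlen, hl⟩ := ih fun j => c (some j)
    refine ⟨c none :: l, ?_, ?_, fun n S y => ?_⟩
    · simp [hsum, Fintype.sum_option]
    · simp [hlen]
    · have hfin : ∀ w, Finite (WeightedRep S (fun j => c (some j)) w) := fun w =>
        Finite.of_injective
          (fun x : WeightedRep S (fun j => c (some j)) w => fun j => (⟨x.1 j, x.2.1 j⟩ : S))
          fun x x' h => Subtype.ext (funext fun j => congrArg Subtype.val (congrFun h j))
      have e : WeightedRep S c y ≃
          Σ v : S, WeightedRep S (fun j => c (some j)) (y - c none • v.1) :=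
        { toFun := fun x => ⟨⟨x.1 none, x.2.1 none⟩, fun j => x.1 (some j), fun j => x.2.1 _, by
            have := x.2.2
            rw [Fintype.sum_option] at this
            exact eq_sub_of_add_eq' this⟩
          invFun := fun x => ⟨fun j => j.elim x.1.1 x.2.1, by
            refine ⟨?_, ?_⟩
            · rintro (_ | j)
              · exact x.1.2
              · exact x.2.2.1 j
            · rw [Fintype.sum_option]
              simp only [Option.elim_none, Option.elim_some]
              rw [x.2.2.2, add_sub_cancel]⟩
          left_inv := fun x => Subtype.ext (funext fun j => by cases j <;> rfl)
          right_inv := fun x => rfl }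
      rw [Nat.card_congr e, Nat.card_sigma, repCount, ← sum_coe_sort]
      exact sum_congr rfl fun v _ => hl _ _ _

theorem exists_subset_forall_card_weightedRep {F : Type*} [Field F] [Fintype F]
    {κ : Type*} [Fintype κ] (ι : κ → Type*) [∀ C, Fintype (ι C)] (c : ∀ C, ι C → F)
    (hc : ∀ C, ∑ j, c C j ≠ 0) {ε : ℝ} (hε : 0 < ε) :
    ∃ δ : ℝ, 0 < δ ∧ ∃ n₀ : ℕ, ∀ n ≥ n₀, ∀ S : Finset (Fin n → F),
      (Fintype.card F : ℝ) ^ ((1 - δ) * n) ≤ #S →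
        ∃ T ⊆ S, (Fintype.card F : ℝ) ^ ((1 - ε) * n) ≤ #T ∧
          ∀ z ∈ T, ∀ C, (Fintype.card F : ℝ) ^ ((Fintype.card (ι C) - 1 - ε) * n) ≤
            Nat.card (WeightedRep S (c C) ((∑ j, c C j) • z)) := by
  classical
  choose l hsum hlen hl using fun C => exists_list_repCount_eq (c C)
  obtain ⟨δ, hδ, n₀, h⟩ := exists_subset_forall_popular (univ.toList.map l) (by
    intro l' hl'
    obtain ⟨C, -, rfl⟩ := List.mem_map.1 hl'
    rw [hsum]
    exact hc C) hε hε
  refine ⟨δ, hδ, n₀, fun n hn S hS => ?_⟩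
  obtain ⟨T, hTS, hT, hpop⟩ := h n hn S hS
  refine ⟨T, hTS, hT, fun z hz C => ?_⟩
  have := hpop z hz (l C) (List.mem_map_of_mem (by simp))
  rwa [hl, hlen, hsum] at this

/-! ### From many solutions to a generic one. -/

namespace LinSys

variable {F : Type*} [Field F] {m k : ℕ}

/-- The solutions of the system with all variables in `S`. -/
abbrev SolutionsIn {n : ℕ} (A : Matrix (Fin m) (Fin k) F) (S : Finset (Fin n → F)) : Type _ :=
  {x : Fin k → Fin n → F // (∀ j, x j ∈ S) ∧ IsSolution A x}

/-- Large sets contain nearly as many solutions as the whole space. -/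
def HasManySolutions [Fintype F] (A : Matrix (Fin m) (Fin k) F) : Prop :=
  ∀ ε : ℝ, 0 < ε → ∃ δ : ℝ, 0 < δ ∧ ∃ n₀ : ℕ, ∀ n ≥ n₀, ∀ S : Finset (Fin n → F),
    (Fintype.card F : ℝ) ^ ((1 - δ) * n) ≤ #S →
      (Fintype.card F : ℝ) ^ ((k - m - ε) * n) ≤ Nat.card (SolutionsIn A S)

/-- Adjoining `b` gives a system of rank `m + 1`, and each of the `n` coordinates of a solution lies
independently in its kernel of dimension `k - m - 1`. -/
theorem card_solutions_and_extra_equation [Fintype F] {A : Matrix (Fin m) (Fin k) F}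
    (hA : LinearIndependent F A.row) {b : Fin k → F} (hb : b ∉ rowSpan A) (n : ℕ) :
    (Nat.card {x : Fin k → Fin n → F // IsSolution A x ∧ ∑ j, b j • x j = 0} : ℝ) ≤
      (Fintype.card F : ℝ) ^ (((k : ℝ) - m - 1) * n) := by
  classical
  let B : Matrix (Fin (m + 1)) (Fin k) F := Matrix.of (Fin.cons b A.row)
  have hB : LinearIndependent F B.row := linearIndependent_finCons.2 ⟨hA, hb⟩
  let K := LinearMap.ker B.mulVecLin
  have hK : (m + 1) + Module.finrank F K = k := by
    have h := LinearMap.finrank_range_add_finrank_ker B.mulVecLin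
    have hr : Module.finrank F (LinearMap.range B.mulVecLin) = m + 1 := by
      have := hB.rank_matrix
      rwa [Fintype.card_fin] at this
    rw [hr, Module.finrank_pi, Fintype.card_fin] at h
    exact h
  have hcard : Nat.card (Fin n → K) = Fintype.card F ^ (Module.finrank F K * n) := by
    rw [Nat.card_fun, Nat.card_eq_fintype_card, Module.card_eq_pow_finrank (K := F),
      Nat.card_eq_fintype_card, Fintype.card_fin, pow_mul]
  have hle : Nat.card {x : Fin k → Fin n → F // IsSolution A x ∧ ∑ j, b j • x j = 0} ≤
      Nat.card (Fin n → K) := by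
    refine Nat.card_le_card_of_injective
      (fun x => fun t => (⟨fun j => x.1 j t, ?_⟩ : K)) ?_
    · rw [LinearMap.mem_ker]
      ext i
      refine Fin.cases ?_ (fun i => ?_) i
      · have := congrFun x.2.2 t
        simpa [B, Matrix.mulVec, dotProduct] using this
      · have := congrFun (x.2.1 i) t
        simpa [B, Matrix.mulVec, dotProduct] using this
    · intro x x' h
      refine Subtype.ext (funext fun j => funext fun t => ?_)
      exact congrFun (congrArg Subtype.val (congrFun h t)) j
  have hK' : ((k : ℝ) - m - 1) * n = ((Module.finrank F K * n : ℕ) : ℝ) := by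
    have : (m : ℝ) + 1 + Module.finrank F K = k := by exact_mod_cast hK
    push_cast
    rw [← this]
    ring
  rw [hK', Real.rpow_natCast]
  exact_mod_cast hle.trans_eq hcard

/-- If no solution is generic, then there are few solutions. -/
theorem card_solutionsIn_le_of_not_generic [Fintype F] {A : Matrix (Fin m) (Fin k) F}
    (hA : LinearIndependent F A.row) {n : ℕ} {S : Finset (Fin n → F)}
    (hS : ∀ x : Fin k → Fin n → F, (∀ j, x j ∈ S) → ¬ IsGenericSolution A x) :
    (Nat.card (SolutionsIn A S) : ℝ) ≤
      (Fintype.card F : ℝ) ^ k * (Fintype.card F : ℝ) ^ (((k : ℝ) - m - 1) * n) := by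
  classical
  have hex : ∀ x : SolutionsIn A S, ∃ b : Fin k → F, b ∉ rowSpan A ∧ ∑ j, b j • x.1 j = 0 := by
    intro x
    by_contra! h
    refine hS x.1 x.2.1 ⟨x.2.2, fun b _ hb => ?_⟩
    by_contra hb'
    exact h b hb' hb
  -- A union bound over the at most `q ^ k` possible extra equations.
  choose b hb hbx using hex
  let Y := Σ b : {b : Fin k → F // b ∉ rowSpan A},
    {x : Fin k → Fin n → F // IsSolution A x ∧ ∑ j, b.1 j • x j = 0}
  have hle : Nat.card (SolutionsIn A S) ≤ Nat.card Y := by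
    refine Nat.card_le_card_of_injective
      (fun x => (⟨⟨b x, hb x⟩, ⟨x.1, x.2.2, hbx x⟩⟩ : Y)) fun x x' h => ?_
    exact Subtype.ext (congrArg (fun y : Y => y.2.1) h)
  rw [Nat.card_sigma] at hle
  calc (Nat.card (SolutionsIn A S) : ℝ)
      ≤ ∑ b : {b : Fin k → F // b ∉ rowSpan A},
          (Nat.card {x : Fin k → Fin n → F // IsSolution A x ∧ ∑ j, b.1 j • x j = 0} : ℝ) := by
        exact_mod_cast hle
    _ ≤ ∑ _b : {b : Fin k → F // b ∉ rowSpan A},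
          (Fintype.card F : ℝ) ^ (((k : ℝ) - m - 1) * n) :=
        sum_le_sum fun b _ => card_solutions_and_extra_equation hA b.2 n
    _ ≤ _ := by
        rw [sum_const, nsmul_eq_mul, card_univ]
        gcongr
        have := Fintype.card_subtype_le fun b : Fin k → F => b ∉ rowSpan A
        rw [Fintype.card_fun, Fintype.card_fin] at this
        exact_mod_cast this

theorem HasManySolutions.isTemperate [Fintype F] {A : Matrix (Fin m) (Fin k) F}
    (h : HasManySolutions A) (hA : LinearIndependent F A.row) : IsTemperate A := by
  obtain ⟨δ, hδ, n₀, hn₀⟩ := h (1 / 2) (by norm_num)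
  have hq := one_lt_card_real F
  have hq0 := zero_lt_one.trans hq
  set q : ℝ := (Fintype.card F : ℝ) with hqdef
  -- Taking `β = q ^ N` forces `n ≥ N`, because `#S ≤ q ^ n`. Then `k < n / 2`, so `q ^ k` does not
  -- bridge the gap between the exponents `(k - m - 1) * n` and `(k - m - 1 / 2) * n`.
  set N := max n₀ (2 * k + 1) with hN
  have hγ1 : 1 ≤ q ^ (1 - min δ 1) := by
    refine Real.one_le_rpow hq.le ?_
    have := min_le_right δ 1
    linarith
  refine ⟨q ^ N, q ^ (1 - min δ 1), by positivity, by positivity, ?_, fun n S hS => ?_⟩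
  · calc q ^ (1 - min δ 1) < q ^ (1 : ℝ) := by
          refine Real.rpow_lt_rpow_of_exponent_lt hq ?_
          have : 0 < min δ 1 := lt_min hδ one_pos
          linarith
      _ = q := Real.rpow_one q
  · have hSle : (#S : ℝ) ≤ q ^ n := by
      have := card_le_univ S
      rw [Fintype.card_fun, Fintype.card_fin] at this
      rw [hqdef]
      exact_mod_cast this
    have hγn : 1 ≤ (q ^ (1 - min δ 1)) ^ n := one_le_pow₀ hγ1
    have hNn : N ≤ n := by
      have h1 : q ^ N ≤ q ^ n := by
        refine le_trans ?_ (hS.trans hSle)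
        exact le_mul_of_one_le_right (by positivity) hγn
      exact (pow_le_pow_iff_right₀ hq).1 h1
    have hSbig : q ^ ((1 - δ) * n) ≤ #S := by
      calc q ^ ((1 - δ) * n) ≤ q ^ ((1 - min δ 1) * n) := by
            refine Real.rpow_le_rpow_of_exponent_le hq.le ?_
            gcongr
            exact min_le_left _ _
        _ = (q ^ (1 - min δ 1)) ^ n := Real.rpow_mul_natCast hq0.le _ _
        _ ≤ q ^ N * (q ^ (1 - min δ 1)) ^ n :=
            le_mul_of_one_le_left (by positivity) (one_le_pow₀ hq.le)
        _ ≤ _ := hS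
    have hmany := hn₀ n ((le_max_left _ _).trans hNn) S hSbig
    by_contra! hno
    have hfew := card_solutionsIn_le_of_not_generic hA hno
    have hlt : q ^ k * q ^ (((k : ℝ) - m - 1) * n) < q ^ (((k : ℝ) - m - 1 / 2) * n) := by
      rw [← Real.rpow_natCast q k, ← Real.rpow_add hq0]
      refine Real.rpow_lt_rpow_of_exponent_lt hq ?_
      have : ((2 * k + 1 : ℕ) : ℝ) ≤ n := by exact_mod_cast (le_max_right _ _).trans hNn
      push_cast at this
      linarith
    exact absurd (hmany.trans hfew) (not_le.2 hlt)

end LinSys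

instance {F V ι : Type*} [Field F] [AddCommGroup V] [Module F V] [Fintype ι]
    (S : Finset V) (c : ι → F) (y : V) : Finite (WeightedRep S c y) :=
  Finite.of_injective (fun x : WeightedRep S c y => fun j => (⟨x.1 j, x.2.1 j⟩ : S))
    fun _ _ h => Subtype.ext (funext fun j => congrArg Subtype.val (congrFun h j))

theorem rpow_sum_le_prod {κ : Type*} [Fintype κ] {q : ℝ} (hq : 0 < q) {g N : κ → ℝ}
    (h : ∀ C, q ^ g C ≤ N C) : q ^ ∑ C, g C ≤ ∏ C, N C := by
  rw [Real.rpow_sum_of_pos hq]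
  exact prod_le_prod (fun C _ => by positivity) fun C _ => h C

theorem card_fst_mul_le_card_sigma {α : Type*} {β : α → Type*} [Fintype α] [∀ a, Finite (β a)]
    {t : ℝ} (h : ∀ a, t ≤ Nat.card (β a)) : Fintype.card α * t ≤ Nat.card (Σ a, β a) := by
  rw [Nat.card_sigma, Nat.cast_sum, ← nsmul_eq_mul, ← card_univ]
  exact card_nsmul_le_sum _ _ _ fun a _ => h a

/-! ### Many solutions from the column classes. -/

namespace LinSys

variable {F : Type*} [Field F] {m k : ℕ}

theorem sum_smul_eq_sum_classes {κ V : Type*} [Fintype κ] [DecidableEq κ] [AddCommGroup V]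
    [Module F V] {A : Matrix (Fin m) (Fin k) F} {f : Fin k → κ} {v : κ → Fin m → F}
    {c : Fin k → F} (hA : ∀ i j, A i j = c j * v (f j) i) (x : Fin k → V) (i : Fin m) :
    ∑ j, A i j • x j = ∑ C, v C i • ∑ j : {j // f j = C}, c j • x j := by
  rw [← (Equiv.sigmaFiberEquiv f).sum_comp, Fintype.sum_sigma]
  refine sum_congr rfl fun C _ => ?_
  rw [smul_sum]
  refine sum_congr rfl fun j _ => ?_
  rw [Equiv.sigmaFiberEquiv_apply, hA, j.2, mul_comm, mul_smul]

theorem sum_card_fiber {κ : Type*} [Fintype κ] [DecidableEq κ] (f : Fin k → κ) :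
    ∑ C, (Fintype.card {j // f j = C} : ℝ) = k := by
  have := Fintype.card_congr (Equiv.sigmaFiberEquiv f)
  rw [Fintype.card_sigma, Fintype.card_fin] at this
  exact_mod_cast this

/-- If the weights in every class have nonzero sum, then one obtains many solutions by
representing the same vector `z` as the weighted mean of each class. -/
theorem hasManySolutions_of_forall_sum_ne_zero [Fintype F] {κ : Type*} [Fintype κ]
    [DecidableEq κ] {A : Matrix (Fin m) (Fin k) F} {f : Fin k → κ} {v : κ → Fin m → F}
    {c : Fin k → F} (hA : ∀ i j, A i j = c j * v (f j) i) (hbal : IsBalanced A)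
    (hc : ∀ C, ∑ j : {j // f j = C}, c j ≠ 0) (hκ : Fintype.card κ = m + 1) :
    HasManySolutions A := by
  intro ε hε
  have hq0 := zero_lt_one.trans (one_lt_card_real F)
  obtain ⟨δ, hδ, n₀, h⟩ := exists_subset_forall_card_weightedRep
    (fun C => {j // f j = C}) (fun C j => c j) hc (ε := ε / (m + 2)) (by positivity)
  refine ⟨δ, hδ, n₀, fun n hn S hS => ?_⟩
  obtain ⟨T, hTS, hT, hrep⟩ := h n hn S hS
  set s : κ → F := fun C => ∑ j : {j // f j = C}, c j with hs
  let Y := Σ z : T, ∀ C, WeightedRep S (fun j : {j // f j = C} => c j) (s C • z.1)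
  have hsol : ∀ (p : Y) (i : Fin m), ∑ j, A i j • (p.2 (f j)).1 ⟨j, rfl⟩ = 0 := by
    intro p i
    have h1 : ∀ C, ∑ j : {j // f j = C}, c j • (p.2 (f j)).1 ⟨j, rfl⟩ =
        ∑ j : {j // f j = C}, c j • p.1.1 := by
      intro C
      rw [← sum_smul, ← (p.2 C).2.2]
      refine sum_congr rfl ?_
      rintro ⟨j, rfl⟩ _
      rfl
    -- The class sums agree with those of the constant family `z`, which is a solution by
    -- balancedness.
    rw [sum_smul_eq_sum_classes hA (fun j => (p.2 (f j)).1 ⟨j, rfl⟩), sum_congr rfl fun C _ => by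
      rw [h1 C], ← sum_smul_eq_sum_classes hA (fun _ => p.1.1), ← sum_smul, hbal i, zero_smul]
  have hinj : Nat.card Y ≤ Nat.card (SolutionsIn A S) := by
    refine Nat.card_le_card_of_injective
      (fun p => (⟨fun j => (p.2 (f j)).1 ⟨j, rfl⟩, fun j => (p.2 (f j)).2.1 _, hsol p⟩ :
        SolutionsIn A S)) ?_
    rintro ⟨z, g⟩ ⟨z', g'⟩ hgg
    have hval : ∀ C, (g C).1 = (g' C).1 := by
      intro C
      funext ⟨j, hj⟩
      subst hj
      exact congrFun (congrArg Subtype.val hgg) j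
    -- The solution determines `z`, because its weighted sum over any class is a nonzero multiple of
    -- `z`.
    have hz : z = z' := by
      obtain ⟨C⟩ : Nonempty κ := Fintype.card_pos_iff.1 (by omega)
      have h1 := (g C).2.2
      rw [hval C, (g' C).2.2] at h1
      exact Subtype.ext (smul_right_injective _ (hc C) h1).symm
    subst hz
    congr 1
    exact funext fun C => Subtype.ext (hval C)
  have hfib : ∀ z : T, (Fintype.card F : ℝ) ^
      ((k - (m + 1) - (m + 1) * (ε / (m + 2))) * n) ≤
        Nat.card (∀ C, WeightedRep S (fun j : {j // f j = C} => c j) (s C • z.1)) := by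
    intro z
    rw [Nat.card_pi, Nat.cast_prod]
    refine le_trans (le_of_eq ?_) (rpow_sum_le_prod hq0 (hrep z.1 z.2))
    congr 1
    rw [← sum_mul, sum_sub_distrib, sum_sub_distrib, sum_card_fiber, sum_const, sum_const,
      card_univ, hκ]
    simp
  calc (Fintype.card F : ℝ) ^ ((k - m - ε) * n)
      = (Fintype.card F : ℝ) ^ ((1 - ε / (m + 2)) * n) *
          (Fintype.card F : ℝ) ^ ((k - (m + 1) - (m + 1) * (ε / (m + 2))) * n) := by
        rw [← Real.rpow_add hq0]
        congr 1
        field_simp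
        ring
    _ ≤ Fintype.card T * (Fintype.card F : ℝ) ^
          ((k - (m + 1) - (m + 1) * (ε / (m + 2))) * n) := by
        rw [Fintype.card_coe]
        gcongr
    _ ≤ Nat.card Y := card_fst_mul_le_card_sigma hfib
    _ ≤ _ := by exact_mod_cast hinj

/-- If the weights in every class sum to zero, then one obtains many solutions from pairs of
families indexed by the classes on which the system takes the same value, by representing the
members of one of the families. -/
theorem hasManySolutions_of_forall_sum_eq_zero [Fintype F] {κ : Type*} [Fintype κ]
    [DecidableEq κ] {A : Matrix (Fin m) (Fin k) F} {f : Fin k → κ} {v : κ → Fin m → F}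
    {c : Fin k → F} (hA : ∀ i j, A i j = c j * v (f j) i) (r : κ → Fin k)
    (hr : ∀ C, f (r C) = C) (hcr : ∀ C, c (r C) = 1)
    (hc : ∀ C, ∑ j : {j // f j = C}, c j = 0) :
    HasManySolutions A := by
  classical
  intro ε hε
  have hq0 := zero_lt_one.trans (one_lt_card_real F)
  set ℓ : ℕ := Fintype.card κ with hℓ
  -- The class without its representative: since the representative has weight `1` and the class
  -- sums to zero, these weights sum to `-1`.
  let ι : κ → Type := fun C => {j : {j // f j = C} // j.1 ≠ r C}
  let w : ∀ C, ι C → F := fun C j => c j.1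
  have hsplit : ∀ {V : Type _} [AddCommGroup V] [Module F V] (C : κ) (x : {j // f j = C} → V),
      ∑ j : {j // f j = C}, c j • x j = x ⟨r C, hr C⟩ + ∑ j : ι C, w C j • x j.1 := by
    intro V _ _ C x
    rw [Fintype.sum_eq_add_sum_subtype_ne _ (⟨r C, hr C⟩ : {j // f j = C}), hcr, one_smul]
    congr 1
    refine Fintype.sum_equiv (Equiv.subtypeEquivRight fun j => ?_) _ _ fun j => rfl
    rw [Ne, Subtype.ext_iff]
  have hw : ∀ C, ∑ j, w C j = -1 := by
    intro C
    have := hsplit C fun _ => (1 : F)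
    simp only [smul_eq_mul, mul_one, hc] at this
    linear_combination -this
  have hι : ∀ C, (Fintype.card (ι C) : ℝ) = Fintype.card {j // f j = C} - 1 := by
    intro C
    have h1 : Fintype.card (ι C) = Fintype.card {j : {j // f j = C} // j ≠ ⟨r C, hr C⟩} :=
      Fintype.card_congr (Equiv.subtypeEquivRight fun j => by rw [Ne, Ne, Subtype.ext_iff])
    have h2 := Fintype.card_subtype_compl fun j : {j // f j = C} => j = ⟨r C, hr C⟩
    rw [Fintype.card_subtype_eq] at h2
    have h3 : 0 < Fintype.card {j // f j = C} := Fintype.card_pos_iff.2 ⟨⟨r C, hr C⟩⟩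
    rw [h1, Fintype.card_congr (Equiv.refl _), h2, Nat.cast_sub (by omega), Nat.cast_one]
  -- The losses are `2 * ℓ * ε'` from the pairs of families in `T` and `ℓ * ε'` from the
  -- representations.
  set ε' : ℝ := ε / (3 * ℓ + 1) with hε'
  obtain ⟨δ, hδ, n₀, h⟩ := exists_subset_forall_card_weightedRep ι w
    (fun C => by rw [hw]; exact neg_ne_zero.2 one_ne_zero) (ε := ε') (by positivity)
  refine ⟨δ, hδ, n₀, fun n hn S hS => ?_⟩
  obtain ⟨T, hTS, hT, hrep⟩ := h n hn S hS
  let φ : (κ → Fin n → F) → (Fin m → Fin n → F) := fun u i => ∑ C, v C i • u C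
  let U : Finset (κ → Fin n → F) := Fintype.piFinset fun _ => T
  let P : Finset ((κ → Fin n → F) × (κ → Fin n → F)) := (U ×ˢ U).filter fun p => φ p.1 = φ p.2
  -- Cauchy–Schwarz for `φ`, which takes at most `q ^ (m * n)` values on the `#T ^ ℓ` families.
  have hP : (Fintype.card F : ℝ) ^ ((2 * ℓ * (1 - ε') - m) * n) ≤ #P := by
    have h1 := sq_card_le_card_mul_sum_ite U φ
    have h2 : ∑ x ∈ U, ∑ y ∈ U, (if φ x = φ y then 1 else 0 : ℕ) = #P := by
      rw [card_filter, sum_product]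
    have h3 : #U = #T ^ ℓ := by simp [U, hℓ]
    rw [h2, h3, Fintype.card_fun, Fintype.card_fun, Fintype.card_fin, Fintype.card_fin] at h1
    have h4 : ((#T : ℝ) ^ ℓ) ^ 2 ≤ ((Fintype.card F : ℝ) ^ n) ^ m * #P := by exact_mod_cast h1
    have hp : 0 < ((Fintype.card F : ℝ) ^ n) ^ m := by positivity
    refine le_of_mul_le_mul_left (le_trans ?_ h4) hp
    calc ((Fintype.card F : ℝ) ^ n) ^ m * (Fintype.card F : ℝ) ^ ((2 * ℓ * (1 - ε') - m) * n)
        = (((Fintype.card F : ℝ) ^ ((1 - ε') * n)) ^ ℓ) ^ 2 := by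
          rw [← pow_mul, ← pow_mul, ← Real.rpow_natCast, ← Real.rpow_add hq0,
            ← Real.rpow_mul_natCast hq0.le]
          congr 1
          push_cast
          ring
      _ ≤ _ := by gcongr
  let Y := Σ p : P, ∀ C, WeightedRep S (w C) ((∑ j, w C j) • p.1.1 C)
  -- The second family is placed at the representatives; the other variables of class `C` have
  -- weighted sum minus the `C`-th member of the first, so the class contributes the difference of
  -- the two.
  let x : Y → Fin k → Fin n → F := fun p j =>
    if hj : j = r (f j) then p.1.1.2 (f j) else (p.2 (f j)).1 ⟨⟨j, rfl⟩, hj⟩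
  have hxr : ∀ p C, x p (r C) = p.1.1.2 C := by
    intro p C
    simp [x, hr]
  have hxι : ∀ p C (j : ι C), x p j.1 = (p.2 C).1 j := by
    rintro p C ⟨⟨j, rfl⟩, hj⟩
    simp only [x]
    rw [dif_neg hj]
  have hxS : ∀ p j, x p j ∈ S := by
    intro p j
    simp only [x]
    split_ifs with hj
    · have := (mem_product.1 (mem_filter.1 p.1.2).1).2
      exact hTS (Fintype.mem_piFinset.1 this _)
    · exact (p.2 (f j)).2.1 _
  have hsumw : ∀ p C, ∑ j : ι C, w C j • x p j.1 = - p.1.1.1 C := by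
    intro p C
    simp_rw [hxι]
    rw [(p.2 C).2.2, hw, neg_one_smul]
  have hsol : ∀ p, IsSolution A (x p) := by
    intro p i
    have hφ : ∑ C, v C i • p.1.1.1 C = ∑ C, v C i • p.1.1.2 C :=
      congrFun (mem_filter.1 p.1.2).2 i
    rw [sum_smul_eq_sum_classes hA]
    have h1 : ∀ C, ∑ j : {j // f j = C}, c j • x p j = p.1.1.2 C - p.1.1.1 C := by
      intro C
      rw [hsplit C fun j => x p j, hsumw, hxr, sub_eq_add_neg]
    simp_rw [h1, smul_sub, sum_sub_distrib]
    rw [hφ, sub_self]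
  have hinj : Nat.card Y ≤ Nat.card (SolutionsIn A S) := by
    refine Nat.card_le_card_of_injective
      (fun p => (⟨x p, hxS p, hsol p⟩ : SolutionsIn A S)) fun p p' hpp => ?_
    have hx : x p = x p' := congrArg Subtype.val hpp
    have h1 : p.1 = p'.1 := by
      refine Subtype.ext (Prod.ext (funext fun C => ?_) (funext fun C => ?_))
      · rw [← neg_inj, ← hsumw, ← hsumw, hx]
      · rw [← hxr, ← hxr, hx]
    have h2 : ∀ C, (p.2 C).1 = (p'.2 C).1 := by
      intro C
      funext j
      rw [← hxι, ← hxι, hx]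
    obtain ⟨p, g⟩ := p
    obtain ⟨p', g'⟩ := p'
    obtain rfl : p = p' := h1
    congr 1
    exact funext fun C => Subtype.ext (h2 C)
  have hfib : ∀ p : P, (Fintype.card F : ℝ) ^ ((k - 2 * ℓ - ℓ * ε') * n) ≤
      Nat.card (∀ C, WeightedRep S (w C) ((∑ j, w C j) • p.1.1 C)) := by
    intro p
    have hpT : ∀ C, p.1.1 C ∈ T := fun C =>
      Fintype.mem_piFinset.1 (mem_product.1 (mem_filter.1 p.2).1).1 C
    rw [Nat.card_pi, Nat.cast_prod]
    refine le_trans (le_of_eq ?_) (rpow_sum_le_prod hq0 fun C => hrep (p.1.1 C) (hpT C) C)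
    congr 1
    simp_rw [hι]
    rw [← sum_mul, sum_sub_distrib, sum_sub_distrib, sum_sub_distrib, sum_card_fiber, sum_const,
      sum_const, card_univ, ← hℓ]
    simp only [nsmul_eq_mul, mul_one]
    ring
  have hεℓ : 3 * ℓ * ε' ≤ ε := by
    have h1 : (3 * ℓ + 1) * ε' = ε := by
      rw [hε']
      field_simp
    have h2 : 0 < ε' := by positivity
    linarith
  calc (Fintype.card F : ℝ) ^ ((k - m - ε) * n)
      ≤ (Fintype.card F : ℝ) ^ ((2 * ℓ * (1 - ε') - m) * n + (k - 2 * ℓ - ℓ * ε') * n) := by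
        refine Real.rpow_le_rpow_of_exponent_le (one_lt_card_real F).le ?_
        rw [← add_mul]
        gcongr
        linarith
    _ = (Fintype.card F : ℝ) ^ ((2 * ℓ * (1 - ε') - m) * n) *
          (Fintype.card F : ℝ) ^ ((k - 2 * ℓ - ℓ * ε') * n) := Real.rpow_add hq0 _ _
    _ ≤ Fintype.card P * (Fintype.card F : ℝ) ^ ((k - 2 * ℓ - ℓ * ε') * n) := by
        rw [Fintype.card_coe]
        gcongr
    _ ≤ Nat.card Y := card_fst_mul_le_card_sigma hfib
    _ ≤ _ := by exact_mod_cast hinj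

/-- Every column is a multiple of a representative of its column equivalence class. -/
theorem exists_representatives (A : Matrix (Fin m) (Fin k) F) :
    ∃ (f : Fin k → columnClasses A) (c : Fin k → F) (r : columnClasses A → Fin k),
      (∀ C j, f j = C ↔ j ∈ C.1) ∧ (∀ i j, A i j = c j * A i (r (f j))) ∧
      (∀ C, f (r C) = C) ∧ ∀ C, c (r C) = 1 := by
  classical
  let P := Finpartition.ofSetoid (columnSetoid A)
  let f : Fin k → columnClasses A := fun j => ⟨P.part j, P.part_mem.2 (mem_univ j)⟩
  have hf : ∀ C j, f j = C ↔ j ∈ C.1 := fun C j => by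
    rw [Subtype.ext_iff]
    exact P.part_eq_iff_mem C.2
  choose r hr using fun C : columnClasses A => P.nonempty_of_mem_parts C.2
  have hfr : ∀ C, f (r C) = C := fun C => (hf C _).2 (hr C)
  have hrel : ∀ j, ∃ a : F, a ≠ 0 ∧ A.col j = a • A.col (r (f j)) := fun j =>
    Finpartition.mem_part_ofSetoid_iff_rel.1 (by
      have h : P.part (r (f j)) = P.part j := congrArg Subtype.val (hfr (f j))
      change j ∈ P.part (r (f j))
      rw [h]
      exact P.mem_part (mem_univ j))
  choose a _ ha using hrel
  -- The scalar is set to `1` at representatives, since for a zero column it would not be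
  -- determined.
  refine ⟨f, fun j => if j = r (f j) then 1 else a j, r, hf, fun i j => ?_, hfr, fun C => ?_⟩
  · dsimp only
    split_ifs with h
    · rw [one_mul, ← h]
    · exact congrFun (ha j) i
  · simp [hfr]

end LinSys

end

theorem theoremB {F : Type*} [Field F] [Fintype F] {m k : ℕ} (A : Matrix (Fin m) (Fin k) F)
    (hRC : LinSys.IsTypeRC A) (hnd : LinSys.IsNondegenerate A) (hirr : ¬ LinSys.IsReducible A)
    (h : ((∀ C ∈ LinSys.columnClasses A, ¬ LinSys.SumsToZero A C) ∧
            (LinSys.columnClasses A).card = m + 1) ∨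
          (∀ C ∈ LinSys.columnClasses A, LinSys.SumsToZero A C)) :
    LinSys.IsTemperate A := by
  classical
  obtain ⟨f, c, r, hf, hA, hfr, hcr⟩ := LinSys.exists_representatives A
  have hsum : ∀ (C : LinSys.columnClasses A) (i : Fin m),
      ∑ j ∈ C.1, A i j = (∑ j : {j // f j = C}, c j) * A i (r C) := by
    intro C i
    rw [Finset.sum_mul, ← Finset.sum_subtype C.1 (fun j => (hf C j).symm) fun j => c j * A i (r C)]
    refine Finset.sum_congr rfl fun j hj => ?_
    rw [hA, (hf C j).2 hj]
  have hzero : ∀ C : LinSys.columnClasses A,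
      LinSys.SumsToZero A C.1 ↔ ∑ j : {j // f j = C}, c j = 0 := by
    intro C
    have hS : LinSys.SumsToZero A C.1 ↔ ∀ i, ∑ j ∈ C.1, A i j = 0 := by
      rw [LinSys.SumsToZero, funext_iff]
      simp [Matrix.col_apply]
    rw [hS]
    refine ⟨fun h0 => ?_, fun h0 i => by rw [hsum, h0, zero_mul]⟩
    -- Every variable is used, so the representative column is nonzero and the scalar sum must
    -- vanish.
    obtain ⟨i, hi⟩ := hnd.2 (r C)
    exact (mul_eq_zero.1 ((hsum C i).symm.trans (h0 i))).resolve_right hi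
  have hmany : LinSys.HasManySolutions A := by
    rcases h with ⟨hC, hcard⟩ | hC
    · exact LinSys.hasManySolutions_of_forall_sum_ne_zero (v := fun C i => A i (r C)) hA hRC.1
        (fun C => fun h0 => hC C.1 C.2 ((hzero C).2 h0)) (by rw [Fintype.card_coe, hcard])
    · exact LinSys.hasManySolutions_of_forall_sum_eq_zero (v := fun C i => A i (r C)) hA r hfr hcr
        fun C => (hzero C).1 (hC C.1 C.2)
  exact hmany.isTemperate hnd.1
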